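/- For positive integers $a,b,c$ let $\mathrm{PP}(a\times b\times c)$ be the finite set of plane partitions fitting in an $a\times b\times c$ box, that is, of lower order ideals $\rho$ of $\mathbb{Z}_{\ge 1}^3$ (with the componentwise order) contained in $[1,a]\times[1,b]\times[1,c]$; the size of $\rho$ is its number of elements. Let $\mathcal{X}_{a\times b\times c}$ be the size of a uniformly random element of $\mathrm{PP}(a\times b\times c)$. For $M\ge 1$ let $\mathcal{IH}_M$ be the sum of $M$ independent random variables uniform on $[0,1]$. For a random variable $\mathcal{X}$ with mean $\mu$ and standard deviation $\sigma>0$ write $\mathcal{X}^*=(\mathcal{X}-\mu)/\sigma$, and identify random variables with their distributions. Put $$\mathbf{M}_{\mathrm{PP}}=\{\mathcal{X}_{a\times b\times c}^* : a,b,c\in\mathbb{Z}_{\ge 1}\},\qquad \mathbf{M}_{\mathcal{IH}}=\{\mathcal{IH}_M^* : M\in\mathbb{Z}_{\ge 1}\},$$ as subsets of the space of all probability distributions on $\mathbb{R}$ with the Lévy metric $$L(\mu,\nu)=\inf\{\varepsilon>0 : F_\mu(x-\varepsilon)-\varepsilon\le F_\nu(x)\le F_\mu(x+\varepsilon)+\varepsilon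 \text{ for all } x\in\mathbb{R}\},$$ where $F_\mu, F_\nu$ are the cumulative distribution functions, and let a bar denote closure in this metric. Then $$\overline{\mathbf{M}_{\mathrm{PP}}}=\mathbf{M}_{\mathrm{PP}}\sqcup\overline{\mathbf{M}_{\mathcal{IH}}}$$ (a disjoint union), and this space is compact. Moreover, the set of limit points (accumulation points) of $\mathbf{M}_{\mathrm{PP}}$ is exactly $\overline{\mathbf{M}_{\mathcal{IH}}}$, and $\overline{\mathbf{M}_{\mathcal{IH}}}=\mathbf{M}_{\mathcal{IH}}\cup\{\mathcal{N}(0,1)\}$. -/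

import Mathlib

open MeasureTheory ProbabilityTheory

noncomputable section

/-! ### Distributions on the line with the Lévy metric -/

/-- A probability distribution on the real line. This is a wrapper around
`ProbabilityMeasure ℝ` that carries the Lévy metric. -/
@[ext]
structure RealLaw where
  /-- The underlying probability measure. -/
  law : ProbabilityMeasure ℝ

namespace RealLaw

/-- The cumulative distribution function `x ↦ μ (-∞, x]`. -/
def distFun (μ : RealLaw) (x : ℝ) : ℝ := cdf (μ.law : Measure ℝ) x

lemma distFun_mono (μ : RealLaw) : Monotone μ.distFun := monotone_cdf _

lemma distFun_nonneg (μ : RealLaw) (x : ℝ) : 0 ≤ μ.distFun x := cdf_nonneg _ x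

lemma distFun_le_one (μ : RealLaw) (x : ℝ) : μ.distFun x ≤ 1 := cdf_le_one _ x

/-- The numbers `ε > 0` with `F (x - ε) - ε ≤ G x ≤ F (x + ε) + ε` for all real `x`,
where `F`, `G` are the distribution functions of `μ`, `ν`. -/
def levySet (μ ν : RealLaw) : Set ℝ :=
  {ε : ℝ | 0 < ε ∧ ∀ x : ℝ,
    μ.distFun (x - ε) - ε ≤ ν.distFun x ∧ ν.distFun x ≤ μ.distFun (x + ε) + ε}

/-- The Lévy distance of two distributions on the line. -/
def levyDist (μ ν : RealLaw) : ℝ := sInf (levySet μ ν)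

lemma levySet_nonempty (μ ν : RealLaw) : (levySet μ ν).Nonempty := by
  refine ⟨1, one_pos, fun x => ⟨?_, ?_⟩⟩
  · linarith [μ.distFun_le_one (x - 1), ν.distFun_nonneg x]
  · linarith [ν.distFun_le_one x, μ.distFun_nonneg (x + 1)]

lemma levySet_bddBelow (μ ν : RealLaw) : BddBelow (levySet μ ν) :=
  ⟨0, fun _ h => h.1.le⟩

lemma levySet_symm_sub (μ ν : RealLaw) : levySet μ ν ⊆ levySet ν μ := by
  rintro ε ⟨h0, h⟩
  refine ⟨h0, fun x => ⟨?_, ?_⟩⟩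
  · have := (h (x - ε)).2
    rw [sub_add_cancel] at this
    linarith
  · have := (h (x + ε)).1
    rw [add_sub_cancel_right] at this
    linarith

lemma levyDist_nonneg (μ ν : RealLaw) : 0 ≤ levyDist μ ν :=
  le_csInf (levySet_nonempty μ ν) fun _ h => h.1.le

lemma levyDist_self (μ : RealLaw) : levyDist μ μ = 0 := by
  refine le_antisymm (le_of_forall_pos_le_add fun ε hε => ?_) (levyDist_nonneg μ μ)
  rw [zero_add]
  refine csInf_le (levySet_bddBelow μ μ) ⟨hε, fun x => ⟨?_, ?_⟩⟩
  · linarith [μ.distFun_mono (show x - ε ≤ x by linarith)]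
  · linarith [μ.distFun_mono (show x ≤ x + ε by linarith)]

lemma levyDist_comm (μ ν : RealLaw) : levyDist μ ν = levyDist ν μ := by
  unfold levyDist
  rw [Set.Subset.antisymm (levySet_symm_sub μ ν) (levySet_symm_sub ν μ)]

lemma levySet_add {μ ν ρ : RealLaw} {ε δ : ℝ} (hε : ε ∈ levySet μ ν) (hδ : δ ∈ levySet ν ρ) :
    ε + δ ∈ levySet μ ρ := by
  obtain ⟨e0, he⟩ := hε
  obtain ⟨d0, hd⟩ := hδ
  refine ⟨add_pos e0 d0, fun x => ⟨?_, ?_⟩⟩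
  · have h1 := (hd x).1
    have h2 := (he (x - δ)).1
    rw [show x - δ - ε = x - (ε + δ) by ring] at h2
    linarith
  · have h1 := (hd x).2
    have h2 := (he (x + δ)).2
    rw [show x + δ + ε = x + (ε + δ) by ring] at h2
    linarith

lemma levyDist_triangle (μ ν ρ : RealLaw) : levyDist μ ρ ≤ levyDist μ ν + levyDist ν ρ := by
  refine le_of_forall_pos_le_add fun η hη => ?_
  obtain ⟨ε, hε, hε'⟩ := Real.lt_sInf_add_pos (levySet_nonempty μ ν) (half_pos hη)
  obtain ⟨δ, hδ, hδ'⟩ := Real.lt_sInf_add_pos (levySet_nonempty ν ρ) (half_pos hη)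
  have := csInf_le (levySet_bddBelow μ ρ) (levySet_add hε hδ)
  unfold levyDist
  linarith

lemma distFun_le_of_levyDist_eq_zero {μ ν : RealLaw} (h : levyDist μ ν = 0) (x : ℝ) :
    ν.distFun x ≤ μ.distFun x := by
  have key : ∀ η : ℝ, 0 < η → ν.distFun x ≤ μ.distFun (x + η) + η := by
    intro η hη
    obtain ⟨ε, hε, hlt⟩ := Real.lt_sInf_add_pos (levySet_nonempty μ ν) hη
    have hlt' : ε < η := by
      have h' : sInf (levySet μ ν) = 0 := h
      rwa [h', zero_add] at hlt
    linarith [(hε.2 x).2, μ.distFun_mono (show x + ε ≤ x + η by linarith)]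
  have hc : Filter.Tendsto μ.distFun (nhdsWithin x (Set.Ici x)) (nhds (μ.distFun x)) :=
    (cdf (μ.law : Measure ℝ)).right_continuous x
  have hu : Filter.Tendsto (fun n : ℕ => x + 1 / ((n : ℝ) + 1)) Filter.atTop
      (nhdsWithin x (Set.Ici x)) := by
    refine tendsto_nhdsWithin_iff.2 ⟨?_, Filter.Eventually.of_forall fun n => ?_⟩
    · simpa using tendsto_const_nhds.add (tendsto_one_div_add_atTop_nhds_zero_nat (𝕜 := ℝ))
    · have : (0 : ℝ) < 1 / ((n : ℝ) + 1) := by positivity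
      exact (le_add_of_nonneg_right this.le : x ≤ x + 1 / ((n : ℝ) + 1))
  have hl := (hc.comp hu).add (tendsto_one_div_add_atTop_nhds_zero_nat (𝕜 := ℝ))
  rw [add_zero] at hl
  exact ge_of_tendsto' hl fun n => key _ (by positivity)

lemma eq_of_levyDist_eq_zero {μ ν : RealLaw} (h : levyDist μ ν = 0) : μ = ν := by
  have h' : levyDist ν μ = 0 := by rw [levyDist_comm, h]
  have hcdf : cdf (μ.law : Measure ℝ) = cdf (ν.law : Measure ℝ) := by
    ext x
    exact le_antisymm (distFun_le_of_levyDist_eq_zero h' x) (distFun_le_of_levyDist_eq_zero h x)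
  exact RealLaw.ext (Subtype.ext (Measure.eq_of_cdf (μ.law : Measure ℝ) (ν.law : Measure ℝ) hcdf))

/-- The Lévy metric; all topological notions for `RealLaw` refer to it. -/
instance instMetricSpace : MetricSpace RealLaw where
  dist := levyDist
  dist_self := levyDist_self
  dist_comm := levyDist_comm
  dist_triangle := levyDist_triangle
  eq_of_dist_eq_zero := eq_of_levyDist_eq_zero

/-- The standardization: if `X` has law `μ`, mean `m` and standard deviation `σ > 0`,
this is the law of `(X - m) / σ`. -/
def standardize (μ : RealLaw) : RealLaw :=
  ⟨μ.law.map (f := fun x : ℝ =>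
      (x - ∫ y, y ∂(μ.law : Measure ℝ)) / √(variance id (μ.law : Measure ℝ)))
    (by fun_prop)⟩

end RealLaw

/-- The standard normal distribution. -/
def stdNormalLaw : RealLaw := ⟨⟨gaussianReal 0 1, inferInstance⟩⟩

/-! ### Irwin–Hall distributions -/

/-- The uniform distribution on `[0, 1]`. -/
def uniformUnitLaw : Measure ℝ := volume.restrict (Set.Icc 0 1)

instance uniformUnitLaw_isProbabilityMeasure : IsProbabilityMeasure uniformUnitLaw :=
  ⟨by simp [uniformUnitLaw]⟩

/-- The Irwin–Hall distribution: the law of the sum of `M` independent random variables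
that are uniform on `[0, 1]`. -/
def irwinHall (M : ℕ) : RealLaw :=
  ⟨ProbabilityMeasure.map (Ω := Fin M → ℝ)
    ⟨Measure.pi fun _ : Fin M => uniformUnitLaw, inferInstance⟩
    (f := fun x => ∑ i, x i) (by fun_prop)⟩

/-- The moduli space of (standardized) Irwin–Hall distributions. The degenerate
distribution `M = 0` has no standardization. -/
def irwinHallModuli : Set RealLaw :=
  {μ | ∃ M : ℕ, 1 ≤ M ∧ μ = (irwinHall M).standardize}

/-! ### Plane partitions in a box -/

open scoped Classical in
/-- Plane partitions that fit inside an `a × b × c` box: the (automatically finite) lower order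
ideals `ρ` of `ℤ_{≥ 1}³`, with the componentwise order, all of whose cells `(i, j, k)`
satisfy `i ≤ a`, `j ≤ b`, `k ≤ c`. -/
def planePartitions (a b c : ℕ+) : Finset (Finset (ℕ+ × ℕ+ × ℕ+)) :=
  {ρ ∈ (Finset.Icc (1, 1, 1) (a, b, c)).powerset | IsLowerSet (ρ : Set (ℕ+ × ℕ+ × ℕ+))}

lemma planePartitions_nonempty (a b c : ℕ+) : (planePartitions a b c).Nonempty :=
  ⟨∅, by simp [planePartitions, isLowerSet_empty]⟩

/-- The distribution of the size (number of cells) of a plane partition that is chosen uniformly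
at random among those that fit inside an `a × b × c` box. -/
def planePartitionSizeLaw (a b c : ℕ+) : RealLaw :=
  ⟨⟨((PMF.uniformOfFinset (planePartitions a b c) (planePartitions_nonempty a b c)).map
      fun ρ => (ρ.card : ℝ)).toMeasure, inferInstance⟩⟩

/-- The moduli space of (standardized) plane partition size distributions. -/
def planePartitionModuli : Set RealLaw :=
  {μ | ∃ a b c : ℕ+, μ = (planePartitionSizeLaw a b c).standardize}

end

/-! Everything is read off from characteristic functions. MacMahon's product for the size generating
function, evaluated at `q = exp (i s)`, shows that near zero the characteristic function of the size
is a phase times `sincRatio`, a product of `a * b` ratios of cardinal sines. Its second-order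
expansion gives mean `a b c / 2` and variance `a b c (a + b + c) / 12`.

By symmetry `c` may be taken to be the largest side. In a sequence of boxes that takes no value
infinitely often, `c` tends to infinity. Either some pair `(a, b)` recurs, and along that
subsequence the denominators tend to `1` and the numerators to a common cardinal sine, so the limit
is the Irwin–Hall law with `M = a b`; or `a b` tends to infinity, all arguments become uniformly
small, and `log (sinc x) = -x²/6 + o(x²)` gives the normal law. These limits
(`tendsto_standardize_planePartitionSizeLaw_irwinHall`,
`tendsto_standardize_planePartitionSizeLaw_stdNormalLaw`) yield sequential compactness, hence the
closures. Disjointness holds because a lattice law has a characteristic function of modulus one at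
some nonzero point, while Irwin–Hall and normal laws do not.

MacMahon's formula comes from computing one Vandermonde determinant in powers of `q` twice: as a
product of differences, and, by repeated row telescoping, as a sum over triangular patterns, which
for `boxExponents` are exactly the plane partitions in the box. -/

noncomputable section

/-! ### The q-analogue of Weyl's dimension formula -/

section Vandermonde

open Finset Matrix

variable {R : Type*} [CommRing R]

/-- Telescoping the rows of a Vandermonde determinant in powers of `q` writes it as a sum of
smaller such determinants over all interlacing exponent vectors. -/
lemma det_vandermonde_pow_succ (q : R) (n : ℕ) (l : Fin (n + 1) → ℕ) (hl : Monotone l) :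
    (vandermonde fun i => q ^ l i).det =
      (∏ k ∈ range n, (q ^ (k + 1) - 1)) *
        ∑ m ∈ Fintype.piFinset fun i : Fin n => Ico (l i.castSucc) (l i.succ),
          q ^ (∑ i, m i) * (vandermonde fun i => q ^ m i).det := by
  -- Subtracting from each row its predecessor leaves the first column equal to `(1, 0, …, 0)`, so
  -- the determinant drops to size `n`.
  have h1 : (vandermonde fun i => q ^ l i).det =
      (Matrix.of fun (i j : Fin (n + 1)) => (Fin.cases (q ^ l 0)
        (fun i => q ^ l i.succ) i : R) ^ (j : ℕ) -
          (Fin.cases 0 (fun i : Fin n => (q ^ l i.castSucc) ^ (j : ℕ)) i : R)).det := by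
    refine det_eq_of_forall_row_eq_smul_add_pred (fun _ => 1) (fun j => ?_) (fun i j => ?_)
    · simp [vandermonde_apply]
    · simp [vandermonde_apply]
  rw [h1, det_succ_column_zero, Fin.sum_univ_succ]
  rw [Finset.sum_eq_zero (s := univ) (fun i _ => by simp), add_zero]
  -- Each entry is a geometric sum times `q ^ (j + 1) - 1`. The latter depends only on the column
  -- and factors out; the sum over `m` is expanded by multilinearity in the rows.
  have h2 : ∀ (i j : Fin n), (q ^ l i.succ) ^ ((j : ℕ) + 1) - (q ^ l i.castSucc) ^ ((j : ℕ) + 1) =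
      (∑ m ∈ Ico (l i.castSucc) (l i.succ), (q ^ m * (q ^ m) ^ (j : ℕ))) * (q ^ ((j : ℕ) + 1) - 1) := by
    intro i j
    have hle : l i.castSucc ≤ l i.succ := hl (Fin.castSucc_lt_succ).le
    simp only [← pow_mul, mul_comm (l _)]
    rw [pow_mul, pow_mul, ← geom_sum_Ico_mul _ hle]
    simp only [pow_succ']
    congr 1
    refine Finset.sum_congr rfl fun m _ => ?_
    ring
  have h3 : ((Matrix.of fun (i j : Fin (n + 1)) => (Fin.cases (q ^ l 0)
        (fun i => q ^ l i.succ) i : R) ^ (j : ℕ) -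
          (Fin.cases 0 (fun i : Fin n => (q ^ l i.castSucc) ^ (j : ℕ)) i : R)).submatrix
            (Fin.succAbove 0) Fin.succ) =
      Matrix.of fun i j : Fin n => (q ^ ((j : ℕ) + 1) - 1) *
        (Matrix.of fun i j : Fin n => ∑ m ∈ Ico (l i.castSucc) (l i.succ),
          (q ^ m * (q ^ m) ^ (j : ℕ))) i j := by
    ext i j
    simp [h2, mul_comm]
  rw [h3, det_mul_row]
  have h4 : (Matrix.of fun i j : Fin n => ∑ m ∈ Ico (l i.castSucc) (l i.succ),
          (q ^ m * (q ^ m) ^ (j : ℕ))).det =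
      ∑ m ∈ Fintype.piFinset fun i : Fin n => Ico (l i.castSucc) (l i.succ),
          q ^ (∑ i, m i) * (vandermonde fun i => q ^ m i).det := by
    have := (detRowAlternating (R := R) (n := Fin n)).toMultilinearMap.map_sum_finset
      (fun i m => (fun j : Fin n => q ^ m * (q ^ m) ^ (j : ℕ)))
      (fun i : Fin n => Ico (l i.castSucc) (l i.succ))
    have e : (Matrix.of fun i j : Fin n => ∑ m ∈ Ico (l i.castSucc) (l i.succ),
          (q ^ m * (q ^ m) ^ (j : ℕ))) = fun i => ∑ m ∈ Ico (l i.castSucc) (l i.succ),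
          (fun j : Fin n => q ^ m * (q ^ m) ^ (j : ℕ)) := by
      ext i j; simp
    rw [e]
    refine this.trans (Finset.sum_congr rfl fun m _ => ?_)
    refine (det_mul_column (fun i => q ^ m i) (vandermonde fun i => q ^ m i)).trans ?_
    rw [Finset.prod_pow_eq_pow_sum]
  rw [h4, Finset.prod_range fun k => q ^ (k + 1) - 1]
  simp

/-- A triangular array `h` with strict increase in the first and weak decrease in the second
coordinate on `{x + y ≤ n}`, with values `l` on the hypotenuse and `0` outside. -/
structure IsTriangularPattern (n : ℕ) (l : Fin (n + 1) → ℕ) (h : ℕ → ℕ → ℕ) : Prop where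
  zero : ∀ x y, n < x + y → h x y = 0
  top : ∀ i : Fin (n + 1), h i (n - i) = l i
  lt : ∀ x y, x + y < n → h x y < h (x + 1) y
  le : ∀ x y, x + y < n → h x (y + 1) ≤ h x y

/-- The triangle `{x + y < n}`. -/
def triangle (n : ℕ) : Finset (ℕ × ℕ) := (range n ×ˢ range n).filter fun p => p.1 + p.2 < n

lemma mem_triangle {n : ℕ} {p : ℕ × ℕ} : p ∈ triangle n ↔ p.1 + p.2 < n := by
  simp [triangle]; omega

lemma sum_triangle_succ (n : ℕ) (h : ℕ → ℕ → ℕ) :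
    ∑ p ∈ triangle (n + 1), h p.1 p.2 =
      ∑ p ∈ triangle n, h p.1 p.2 + ∑ i : Fin (n + 1), h i (n - i) := by
  have : triangle (n + 1) = triangle n ∪ antidiagonal n := by
    ext p; simp [mem_triangle]; omega
  rw [this, sum_union, Finset.Nat.sum_antidiagonal_eq_sum_range_succ h, Finset.sum_range]
  rw [Finset.disjoint_left]
  intro p; simp [mem_triangle]; omega

/-- The Vandermonde determinant as a generating function of triangular patterns. -/
theorem exists_det_vandermonde_pow_eq_sum (q : R) (n : ℕ) (l : Fin (n + 1) → ℕ) (hl : Monotone l) :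
    ∃ F : Finset (ℕ → ℕ → ℕ), (∀ h, h ∈ F ↔ IsTriangularPattern n l h) ∧
      (vandermonde fun i => q ^ l i).det =
        (∏ r ∈ range (n + 1), ∏ k ∈ range r, (q ^ (k + 1) - 1)) *
          ∑ h ∈ F, q ^ (∑ p ∈ triangle n, h p.1 p.2) := by
  classical
  induction n with
  | zero =>
    refine ⟨{fun x y => if x = 0 ∧ y = 0 then l 0 else 0}, fun h => ?_, ?_⟩
    · rw [mem_singleton]
      constructor
      · rintro rfl
        refine ⟨fun x y hxy => ?_, fun i => ?_, by simp, by simp⟩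
        · rw [if_neg]; omega
        · obtain rfl : i = 0 := Fin.ext (by omega)
          simp
      · intro H
        ext x y
        split_ifs with h0
        · obtain ⟨rfl, rfl⟩ := h0
          exact H.top 0
        · exact H.zero _ _ (by omega)
    · simp [triangle]
  | succ n ih =>
    have hmono : ∀ m ∈ Fintype.piFinset fun i : Fin (n + 1) => Ico (l i.castSucc) (l i.succ),
        Monotone m := by
      intro m hm
      rw [Fin.monotone_iff_le_succ]
      intro i
      rw [Fintype.mem_piFinset] at hm
      have h1 := mem_Ico.1 (hm i.castSucc)
      have h2 := mem_Ico.1 (hm i.succ)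
      rw [← Fin.succ_castSucc] at h2
      omega
    choose! F hF hsum using ih
    -- A pattern of size `n + 1` is one of size `n` whose hypotenuse `m` interlaces with `l`, with
    -- `l` added as the new hypotenuse.
    let glue : (ℕ → ℕ → ℕ) → ℕ → ℕ → ℕ := fun g x y =>
      if e : x + y = n + 1 then l ⟨x, by omega⟩ else g x y
    have glue_of_le : ∀ g x y, x + y ≤ n → glue g x y = g x y := fun g x y hxy => by
      simp only [glue]; rw [dif_neg]; omega
    let S := Fintype.piFinset fun i : Fin (n + 1) => Ico (l i.castSucc) (l i.succ)
    refine ⟨(S.sigma F).image fun p => glue p.2, fun h => ?_, ?_⟩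
    · rw [mem_image]
      constructor
      · rintro ⟨⟨m, g⟩, hp, rfl⟩
        obtain ⟨hm, hg⟩ := mem_sigma.1 hp
        have hG := (hF m (hmono m hm) g).1 hg
        have hm' := fun i => mem_Ico.1 (Fintype.mem_piFinset.1 hm i)
        dsimp only
        refine ⟨fun x y hxy => ?_, fun i => ?_, fun x y hxy => ?_, fun x y hxy => ?_⟩
        · simp only [glue]; rw [dif_neg (by omega)]; exact hG.zero _ _ (by omega)
        · simp only [glue]; rw [dif_pos (by omega)]
        · rw [glue_of_le g x y (by omega)]
          by_cases hn : x + y = n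
          · have := (hm' ⟨x, by omega⟩).2
            have ht := hG.top ⟨x, by omega⟩
            simp only [glue]; rw [dif_pos (by omega)]
            have : n - x = y := by omega
            simp only [this] at ht
            rw [ht]; assumption
          · rw [glue_of_le g _ y (by omega)]; exact hG.lt _ _ (by omega)
        · rw [glue_of_le g x y (by omega)]
          by_cases hn : x + y = n
          · have := (hm' ⟨x, by omega⟩).1
            have ht := hG.top ⟨x, by omega⟩
            simp only [glue]; rw [dif_pos (by omega)]
            have : n - x = y := by omega
            simp only [this] at ht
            rw [ht]; assumption
          · rw [glue_of_le g _ _ (by omega)]; exact hG.le _ _ (by omega)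
      · intro H
        have hm : (fun i : Fin (n + 1) => h i (n - i)) ∈ S := by
          refine Fintype.mem_piFinset.2 fun i => mem_Ico.2 ⟨?_, ?_⟩
          · have := H.le i (n - i) (by omega)
            rw [← H.top i.castSucc]
            have e : n + 1 - (i.castSucc : ℕ) = n - i + 1 := by simp; omega
            rw [e]; exact this
          · have := H.lt i (n - i) (by omega)
            rw [← H.top i.succ]
            have e : n + 1 - (i.succ : ℕ) = n - i := by simp
            rw [e]; exact this
        refine ⟨⟨fun i => h i (n - i), fun x y => if x + y ≤ n then h x y else 0⟩, ?_, ?_⟩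
        · refine mem_sigma.2 ⟨hm, (hF _ (hmono _ hm) _).2 ⟨fun x y hxy => ?_, fun i => ?_,
            fun x y hxy => ?_, fun x y hxy => ?_⟩⟩
          · exact if_neg (by omega)
          · exact if_pos (by omega)
          · dsimp only; rw [if_pos (by omega), if_pos (by omega)]; exact H.lt _ _ (by omega)
          · dsimp only; rw [if_pos (by omega), if_pos (by omega)]; exact H.le _ _ (by omega)
        · ext x y
          simp only [glue]
          split_ifs with h1 h2
          · rw [← H.top]; congr; simp; omega
          · rfl
          · exact (H.zero _ _ (by omega)).symm
    -- Gluing forgets `m`, but `m` is the hypotenuse of `g` and so is recovered from it.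
    · have hinj : Set.InjOn (fun p : (_ : Fin (n + 1) → ℕ) × (ℕ → ℕ → ℕ) => glue p.2)
          (S.sigma F : Finset _) := by
        rintro ⟨m, g⟩ hp ⟨m', g'⟩ hp' heq
        obtain ⟨hm, hg⟩ := mem_sigma.1 (mem_coe.1 hp)
        obtain ⟨hm', hg'⟩ := mem_sigma.1 (mem_coe.1 hp')
        have hG := (hF m (hmono m hm) g).1 hg
        have hG' := (hF m' (hmono m' hm') g').1 hg'
        have e : g = g' := by
          ext x y
          by_cases hxy : x + y ≤ n
          · rw [← glue_of_le g x y hxy, ← glue_of_le g' x y hxy]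
            exact congrFun (congrFun heq x) y
          · rw [hG.zero _ _ (by omega), hG'.zero _ _ (by omega)]
        have e' : m = m' := by
          ext i; rw [← hG.top i, ← hG'.top i, e]
        subst e; subst e'; rfl
      rw [sum_image hinj, sum_sigma, det_vandermonde_pow_succ q (n + 1) l hl, prod_range_succ _ (n + 1),
        mul_comm (∏ r ∈ range (n + 1), ∏ k ∈ range r, (q ^ (k + 1) - 1)), mul_assoc]
      congr 1
      rw [mul_sum]
      refine sum_congr rfl fun m hm => ?_
      rw [hsum m (hmono m hm), mul_left_comm]
      congr 1
      rw [mul_sum]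
      refine sum_congr rfl fun g hg => ?_
      have hG := (hF m (hmono m hm) g).1 hg
      rw [← pow_add, sum_triangle_succ, add_comm]
      congr 2
      · refine sum_congr rfl fun p hp => (glue_of_le g _ _ ?_).symm
        have := mem_triangle.1 hp; omega
      · refine sum_congr rfl fun i _ => ?_
        rw [glue_of_le g _ _ (by omega), hG.top]

end Vandermonde

/-! ### Plane partitions as triangular patterns -/

section PlanePartition

open Finset

namespace IsTriangularPattern

variable {n : ℕ} {l : Fin (n + 1) → ℕ} {h : ℕ → ℕ → ℕ}

lemma add_sub_le (H : IsTriangularPattern n l h) {x x' y : ℕ} (hx : x ≤ x') (hn : x' + y ≤ n) :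
    h x y + (x' - x) ≤ h x' y := by
  induction x', hx using Nat.le_induction with
  | base => simp
  | succ x' hx ih =>
    have := ih (by omega)
    have := H.lt x' y (by omega)
    omega

lemma le_of_le (H : IsTriangularPattern n l h) {x y y' : ℕ} (hy : y ≤ y') (hn : x + y' ≤ n) :
    h x y' ≤ h x y := by
  induction y', hy using Nat.le_induction with
  | base => simp
  | succ y' hy ih => exact (H.le x y' (by omega)).trans (ih (by omega))

lemma le_apply (H : IsTriangularPattern n l h) {x y : ℕ} (hn : x + y ≤ n) : x ≤ h x y := by
  have := H.add_sub_le (Nat.zero_le x) hn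
  omega

end IsTriangularPattern

/-- The exponents `0, …, b - 1, b + c, …, a + b + c - 1` attached to an `a × b × c` box. -/
def boxExponents (a b c : ℕ) (i : Fin (a + b - 1 + 1)) : ℕ := i + if b ≤ i then c else 0

lemma boxExponents_strictMono (a b c : ℕ) : StrictMono (boxExponents a b c) := by
  intro i j hij
  have : (i : ℕ) < j := hij
  simp only [boxExponents]
  split_ifs <;> omega

section Box

variable {a b c : ℕ} {h : ℕ → ℕ → ℕ}

lemma IsTriangularPattern.box_top (H : IsTriangularPattern (a + b - 1) (boxExponents a b c) h)
    {x y : ℕ} (hxy : x + y = a + b - 1) : h x y = x + if b ≤ x then c else 0 := by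
  have := H.top ⟨x, by omega⟩
  simp only [boxExponents, show a + b - 1 - x = y by omega] at this
  exact this

/-- Moving to the hypotenuse along the first coordinate bounds the entry above, along the second
coordinate below, and the bounds agree. With `box_of_le_right` this freezes everything outside a `b
× a` rectangle. -/
lemma IsTriangularPattern.box_of_le_left
    (H : IsTriangularPattern (a + b - 1) (boxExponents a b c) h)
    {x y : ℕ} (hx : b ≤ x) (hxy : x + y ≤ a + b - 1) : h x y = x + c := by
  have h1 := H.add_sub_le (show x ≤ a + b - 1 - y by omega) (show a + b - 1 - y + y ≤ _ by omega)
  have h2 := H.le_of_le (show y ≤ a + b - 1 - x by omega) (show x + (a + b - 1 - x) ≤ _ by omega)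
  rw [H.box_top (x := a + b - 1 - y) (by omega), if_pos (by omega)] at h1
  rw [H.box_top (by omega), if_pos (by omega)] at h2
  omega

lemma IsTriangularPattern.box_of_le_right (ha : 0 < a)
    (H : IsTriangularPattern (a + b - 1) (boxExponents a b c) h)
    {x y : ℕ} (hy : a ≤ y) (hxy : x + y ≤ a + b - 1) : h x y = x := by
  have h1 := H.add_sub_le (show x ≤ a + b - 1 - y by omega) (show a + b - 1 - y + y ≤ _ by omega)
  have h2 := H.le_apply hxy
  rw [H.box_top (x := a + b - 1 - y) (by omega), if_neg (by omega)] at h1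
  omega

lemma IsTriangularPattern.box_le
    (H : IsTriangularPattern (a + b - 1) (boxExponents a b c) h)
    {x y : ℕ} (hxy : x + y ≤ a + b - 1) : h x y ≤ x + c := by
  have h1 := H.add_sub_le (show x ≤ a + b - 1 - y by omega) (show a + b - 1 - y + y ≤ _ by omega)
  rw [H.box_top (x := a + b - 1 - y) (by omega)] at h1
  split_ifs at h1 <;> omega

end Box

lemma mem_planePartitions {a b c : ℕ+} {ρ : Finset (ℕ+ × ℕ+ × ℕ+)} :
    ρ ∈ planePartitions a b c ↔
      (∀ i j k, (i, j, k) ∈ ρ → i ≤ a ∧ j ≤ b ∧ k ≤ c) ∧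
        IsLowerSet (ρ : Set (ℕ+ × ℕ+ × ℕ+)) := by
  classical
  rw [planePartitions, mem_filter, mem_powerset]
  refine and_congr_left fun _ => ⟨fun H i j k hp => ?_, fun H p hp => ?_⟩
  · have := (mem_Icc.1 (H hp)).2
    exact ⟨this.1, this.2.1, this.2.2⟩
  · obtain ⟨i, j, k⟩ := p
    obtain ⟨h1, h2, h3⟩ := H i j k hp
    exact mem_Icc.2 ⟨⟨one_le, one_le, one_le⟩, ⟨h1, h2, h3⟩⟩

/-- The number of cells `(i + 1, j + 1, k + 1)` with `k < c` of a set of cells. -/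
def columnHeight (c : ℕ) (ρ : Finset (ℕ+ × ℕ+ × ℕ+)) (i j : ℕ) : ℕ :=
  #{k ∈ range c | (i.succPNat, j.succPNat, k.succPNat) ∈ ρ}

lemma columnHeight_le (c : ℕ) (ρ : Finset (ℕ+ × ℕ+ × ℕ+)) (i j : ℕ) :
    columnHeight c ρ i j ≤ c :=
  (card_filter_le _ _).trans (card_range c).le

/-- A column of an order ideal is an initial segment, so its cardinality decides membership. -/
lemma mem_iff_lt_columnHeight {a b c : ℕ+} {ρ : Finset (ℕ+ × ℕ+ × ℕ+)}
    (hρ : ρ ∈ planePartitions a b c) {i j k : ℕ} :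
    (i.succPNat, j.succPNat, k.succPNat) ∈ ρ ↔ k < columnHeight c ρ i j := by
  obtain ⟨hbox, hlow⟩ := mem_planePartitions.1 hρ
  have hdown : ∀ {k k' : ℕ}, k' ≤ k → (i.succPNat, j.succPNat, k.succPNat) ∈ ρ →
      (i.succPNat, j.succPNat, k'.succPNat) ∈ ρ := fun {k k'} hk hm =>
    hlow (show (i.succPNat, j.succPNat, k'.succPNat) ≤ (i.succPNat, j.succPNat, k.succPNat) from
      ⟨le_rfl, le_rfl, Nat.succPNat_le_succPNat.2 hk⟩) hm
  constructor
  · intro hm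
    have hk : k < c := by
      have := (hbox _ _ _ hm).2.2
      rw [← PNat.coe_le_coe, Nat.succPNat_coe] at this
      exact this
    have : range (k + 1) ⊆ {k ∈ range c | (i.succPNat, j.succPNat, k.succPNat) ∈ ρ} := fun k' hk' => by
      have := mem_range.1 hk'
      exact mem_filter.2 ⟨mem_range.2 (by omega), hdown (by omega) hm⟩
    simpa [columnHeight] using card_le_card this
  · intro hk
    by_contra hm
    have : ({k ∈ range c | (i.succPNat, j.succPNat, k.succPNat) ∈ ρ} : Finset ℕ) ⊆ range k :=
      fun k' hk' => by
        refine mem_range.2 (lt_of_not_ge fun hle => hm (hdown hle (mem_filter.1 hk').2))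
    have := card_le_card this
    rw [card_range] at this
    exact absurd hk (not_lt.2 this)

lemma sum_columnHeight {a b c : ℕ+} {ρ : Finset (ℕ+ × ℕ+ × ℕ+)}
    (hρ : ρ ∈ planePartitions a b c) :
    ∑ p ∈ range b ×ˢ range a, columnHeight c ρ p.2 (b - 1 - p.1) = #ρ := by
  obtain ⟨hbox, -⟩ := mem_planePartitions.1 hρ
  have : ∀ p ∈ range b ×ˢ range a, columnHeight c ρ p.2 (b - 1 - p.1) =
      ∑ k ∈ range c, if (p.2.succPNat, (b - 1 - p.1).succPNat, k.succPNat) ∈ ρ then 1 else 0 := by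
    intro p _
    rw [columnHeight, card_filter]
  rw [sum_congr rfl this, ← sum_product', ← card_filter]
  refine card_bij' (fun p _ => (p.1.2.succPNat, ((b : ℕ) - 1 - p.1.1).succPNat, p.2.succPNat))
    (fun p _ => ((b - p.2.1, p.1 - 1), p.2.2 - 1)) ?_ ?_ ?_ ?_
  · intro p hp
    exact (mem_filter.1 hp).2
  · rintro ⟨i, j, k⟩ hp
    obtain ⟨h1, h2, h3⟩ := hbox _ _ _ hp
    rw [← PNat.coe_le_coe] at h1 h2 h3
    have := i.pos; have := j.pos; have := k.pos
    simp only [mem_filter, mem_product, mem_range]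
    refine ⟨by omega, ?_⟩
    convert hp using 2
    · exact PNat.eq (by simp only [Nat.succPNat_coe]; omega)
    congr 1
    · exact PNat.eq (by simp only [Nat.succPNat_coe]; omega)
    · exact PNat.eq (by simp only [Nat.succPNat_coe]; omega)
  · rintro ⟨⟨x, y⟩, k⟩ hp
    simp only [mem_filter, mem_product, mem_range] at hp
    simp only [Nat.succPNat_coe, Prod.mk.injEq]
    omega
  · rintro ⟨i, j, k⟩ hp
    obtain ⟨h1, h2, h3⟩ := hbox _ _ _ hp
    rw [← PNat.coe_le_coe] at h1 h2 h3
    have := i.pos; have := j.pos; have := k.pos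
    simp only [Prod.mk.injEq]
    refine ⟨?_, ?_, ?_⟩ <;> exact PNat.eq (by simp only [Nat.succPNat_coe]; omega)

/-- The triangular pattern of a plane partition in a box. -/
def patternOf (a b c : ℕ) (ρ : Finset (ℕ+ × ℕ+ × ℕ+)) (x y : ℕ) : ℕ :=
  if a + b - 1 < x + y then 0 else
    x + if b ≤ x then c else if a ≤ y then 0 else columnHeight c ρ y (b - 1 - x)

lemma patternOf_of_le {a b c : ℕ} {ρ : Finset (ℕ+ × ℕ+ × ℕ+)} {x y : ℕ} (h : x + y ≤ a + b - 1) :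
    patternOf a b c ρ x y =
      x + if b ≤ x then c else if a ≤ y then 0 else columnHeight c ρ y (b - 1 - x) :=
  if_neg (not_lt.2 h)

/-- The plane partition of a triangular pattern. -/
def cellsOf (a b c : ℕ+) (h : ℕ → ℕ → ℕ) : Finset (ℕ+ × ℕ+ × ℕ+) :=
  {p ∈ Icc (1, 1, 1) (a, b, c) | (p.2.2 : ℕ) + (b - p.2.1) ≤ h (b - p.2.1) (p.1 - 1)}

lemma mem_cellsOf {a b c : ℕ+} {h : ℕ → ℕ → ℕ} {i j k : ℕ+} :
    (i, j, k) ∈ cellsOf a b c h ↔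
      (i ≤ a ∧ j ≤ b ∧ k ≤ c) ∧ (k : ℕ) + (b - j) ≤ h (b - j) (i - 1) := by
  rw [cellsOf, mem_filter, mem_Icc]
  refine and_congr_left fun _ => ⟨fun H => ⟨H.2.1, H.2.2.1, H.2.2.2⟩, fun H => ⟨⟨one_le,
    one_le, one_le⟩, ⟨H.1, H.2.1, H.2.2⟩⟩⟩

/-- Column heights decrease weakly in both directions. Reflecting the second index makes them
increase weakly in `x`, and adding `x` makes this strict; the frozen values `c` and `0` fit since
heights lie between them. -/
lemma patternOf_isTriangularPattern {a b c : ℕ+} {ρ : Finset (ℕ+ × ℕ+ × ℕ+)}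
    (hρ : ρ ∈ planePartitions a b c) :
    IsTriangularPattern (a + b - 1) (boxExponents a b c) (patternOf a b c ρ) := by
  have ha := a.pos
  have hb := b.pos
  obtain ⟨-, hlow⟩ := mem_planePartitions.1 hρ
  have anti : ∀ {i i' j j' : ℕ}, i ≤ i' → j ≤ j' → columnHeight c ρ i' j' ≤ columnHeight c ρ i j := by
    intro i i' j j' hi hj
    by_contra hlt
    rw [not_le] at hlt
    refine lt_irrefl (columnHeight c ρ i j) ((mem_iff_lt_columnHeight hρ).1 (hlow
      (show (_, _, _) ≤ (_, _, _) from
        ⟨Nat.succPNat_le_succPNat.2 hi, Nat.succPNat_le_succPNat.2 hj, le_rfl⟩)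
      (mem_coe.2 ((mem_iff_lt_columnHeight hρ).2 hlt))))
  refine ⟨fun x y hxy => if_pos hxy, fun i => ?_, fun x y hxy => ?_, fun x y hxy => ?_⟩
  · rw [patternOf_of_le (by omega), boxExponents]
    split_ifs
    · rfl
    · rfl
    · omega
  · rw [patternOf_of_le (by omega), patternOf_of_le (by omega)]
    have h1 := columnHeight_le c ρ y (b - 1 - x)
    have h2 := anti (le_refl y) (show (b : ℕ) - 1 - (x + 1) ≤ b - 1 - x by omega)
    split_ifs <;> omega
  · rw [patternOf_of_le (by omega), patternOf_of_le (by omega)]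
    have h2 := anti (Nat.le_add_right y 1) (le_refl ((b : ℕ) - 1 - x))
    split_ifs <;> omega

lemma cellsOf_mem_planePartitions {a b c : ℕ+} {h : ℕ → ℕ → ℕ}
    (H : IsTriangularPattern (a + b - 1) (boxExponents a b c) h) :
    cellsOf a b c h ∈ planePartitions a b c := by
  refine mem_planePartitions.2 ⟨fun i j k hp => (mem_cellsOf.1 hp).1, ?_⟩
  rintro ⟨i, j, k⟩ ⟨i', j', k'⟩ hle hp
  obtain ⟨hi, hj, hk⟩ : i' ≤ i ∧ j' ≤ j ∧ k' ≤ k := ⟨hle.1, hle.2.1, hle.2.2⟩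
  obtain ⟨⟨h1, h2, h3⟩, h4⟩ := mem_cellsOf.1 (mem_coe.1 hp)
  refine mem_coe.2 (mem_cellsOf.2 ⟨⟨hi.trans h1, hj.trans h2, hk.trans h3⟩, ?_⟩)
  rw [← PNat.coe_le_coe] at h1 h2 h3 hi hj hk
  have := i.pos; have := i'.pos; have := j.pos; have := j'.pos; have := k'.pos
  have e1 := H.le_of_le (x := (b : ℕ) - j) (show (i' : ℕ) - 1 ≤ i - 1 by omega) (by omega)
  have e2 := H.add_sub_le (y := (i' : ℕ) - 1) (show (b : ℕ) - j ≤ b - j' by omega) (by omega)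
  omega

lemma cellsOf_patternOf {a b c : ℕ+} {ρ : Finset (ℕ+ × ℕ+ × ℕ+)}
    (hρ : ρ ∈ planePartitions a b c) : cellsOf a b c (patternOf a b c ρ) = ρ := by
  obtain ⟨hbox, -⟩ := mem_planePartitions.1 hρ
  ext ⟨i, j, k⟩
  rw [mem_cellsOf]
  have key : i ≤ a ∧ j ≤ b ∧ k ≤ c →
      ((k : ℕ) + (b - j) ≤ patternOf a b c ρ (b - j) (i - 1) ↔ (i, j, k) ∈ ρ) := by
    rintro ⟨h1, h2, h3⟩
    rw [← PNat.coe_le_coe] at h1 h2 h3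
    have := i.pos; have := j.pos; have := k.pos
    rw [patternOf_of_le (by omega), if_neg (by omega), if_neg (by omega)]
    have e := mem_iff_lt_columnHeight hρ (i := i - 1) (j := j - 1) (k := k - 1)
    have e1 : ((i : ℕ) - 1).succPNat = i := PNat.eq (by simp only [Nat.succPNat_coe]; omega)
    have e2 : ((j : ℕ) - 1).succPNat = j := PNat.eq (by simp only [Nat.succPNat_coe]; omega)
    have e3 : ((k : ℕ) - 1).succPNat = k := PNat.eq (by simp only [Nat.succPNat_coe]; omega)
    rw [e1, e2, e3] at e
    rw [e, show (b : ℕ) - 1 - (b - j) = j - 1 by omega]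
    omega
  exact ⟨fun hp => (key hp.1).1 hp.2, fun hp => ⟨hbox _ _ _ hp, (key (hbox _ _ _ hp)).2 hp⟩⟩

lemma columnHeight_cellsOf {a b c : ℕ+} {h : ℕ → ℕ → ℕ}
    (H : IsTriangularPattern (a + b - 1) (boxExponents a b c) h) {x y : ℕ} (hx : x < b)
    (hy : y < a) : x + columnHeight c (cellsOf a b c h) y (b - 1 - x) = h x y := by
  have h1 := H.box_le (show x + y ≤ a + b - 1 by omega)
  have h2 := H.le_apply (show x + y ≤ a + b - 1 by omega)
  have key : ∀ k, k < columnHeight c (cellsOf a b c h) y (b - 1 - x) ↔ k < h x y - x := by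
    intro k
    rw [← mem_iff_lt_columnHeight (cellsOf_mem_planePartitions H), mem_cellsOf]
    simp only [← PNat.coe_le_coe, Nat.succPNat_coe]
    rw [show (b : ℕ) - (b - 1 - x).succ = x by omega, show y.succ - 1 = y by omega]
    omega
  -- Two naturals with the same strict lower bounds are equal; it suffices to test each of them.
  have e1 := key (columnHeight c (cellsOf a b c h) y (b - 1 - x))
  have e2 := key (h x y - x)
  omega

lemma patternOf_cellsOf {a b c : ℕ+} {h : ℕ → ℕ → ℕ}
    (H : IsTriangularPattern (a + b - 1) (boxExponents a b c) h) :
    patternOf a b c (cellsOf a b c h) = h := by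
  ext x y
  rw [patternOf]
  split_ifs with h1 h2 h3
  · exact (H.zero _ _ h1).symm
  · exact (H.box_of_le_left h2 (by omega)).symm
  · exact (H.box_of_le_right a.pos h3 (by omega)).symm
  · exact columnHeight_cellsOf H (by omega) (by omega)

/-- The first sum on the right is the total of the pattern of the empty partition; only the free
rectangle depends on `ρ`, and there the column heights add up to the size. -/
lemma sum_patternOf {a b c : ℕ+} {ρ : Finset (ℕ+ × ℕ+ × ℕ+)}
    (hρ : ρ ∈ planePartitions a b c) :
    ∑ p ∈ triangle (a + b - 1), patternOf a b c ρ p.1 p.2 =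
      ∑ p ∈ triangle (a + b - 1), (p.1 + if (b : ℕ) ≤ p.1 then (c : ℕ) else 0) + #ρ := by
  have hsub : range b ×ˢ range a ⊆ triangle (a + b - 1) := fun p hp => by
    rw [mem_product, mem_range, mem_range] at hp
    rw [mem_triangle]; omega
  rw [← sum_columnHeight hρ, ← sum_sdiff hsub,
    ← sum_sdiff (f := fun p : ℕ × ℕ => p.1 + if (b : ℕ) ≤ p.1 then (c : ℕ) else 0) hsub, add_assoc,
    ← sum_add_distrib]
  congr 1
  · refine sum_congr rfl fun p hp => ?_
    simp only [mem_sdiff, mem_product, mem_range, mem_triangle] at hp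
    rw [patternOf_of_le (by omega)]
    split_ifs <;> omega
  · refine sum_congr rfl fun p hp => ?_
    rw [mem_product, mem_range, mem_range] at hp
    rw [patternOf_of_le (by omega), if_neg (by omega), if_neg (by omega), if_neg (by omega)]
    omega

lemma det_vandermonde_boxExponents {R : Type*} [CommRing R] (q : R) (a b c : ℕ+) :
    (Matrix.vandermonde fun i => q ^ boxExponents a b c i).det =
      (∏ r ∈ range (a + b - 1 + 1), ∏ k ∈ range r, (q ^ (k + 1) - 1)) *
        (q ^ (∑ p ∈ triangle (a + b - 1), (p.1 + if (b : ℕ) ≤ p.1 then (c : ℕ) else 0)) *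
          ∑ ρ ∈ planePartitions a b c, q ^ #ρ) := by
  obtain ⟨F, hF, hdet⟩ := exists_det_vandermonde_pow_eq_sum q (a + b - 1) (boxExponents a b c)
    (boxExponents_strictMono a b c).monotone
  rw [hdet]
  congr 1
  rw [mul_sum]
  refine (sum_bij' (fun ρ _ => patternOf a b c ρ) (fun h _ => cellsOf a b c h) ?_ ?_ ?_ ?_ ?_).symm
  · exact fun ρ hρ => (hF _).2 (patternOf_isTriangularPattern hρ)
  · exact fun h hh => cellsOf_mem_planePartitions ((hF _).1 hh)
  · exact fun ρ hρ => cellsOf_patternOf hρ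
  · exact fun h hh => patternOf_cellsOf ((hF _).1 hh)
  · intro ρ hρ
    rw [sum_patternOf hρ, pow_add]

end PlanePartition

/-! ### MacMahon's formula -/

section MacMahon

open Finset

lemma det_vandermonde_eq_prod_range {R : Type*} [CommRing R] (n : ℕ) (f : ℕ → R) :
    (Matrix.vandermonde fun i : Fin n => f i).det =
      ∏ j ∈ range n, ∏ i ∈ range j, (f j - f i) := by
  rw [Matrix.det_vandermonde, prod_sigma', prod_sigma']
  refine prod_bij' (fun p _ => ⟨(p.2 : ℕ), (p.1 : ℕ)⟩)
    (fun p hp => ⟨⟨p.2, ?_⟩, ⟨p.1, ?_⟩⟩) ?_ ?_ ?_ ?_ ?_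
  · simp only [mem_sigma, mem_range] at hp; omega
  · simp only [mem_sigma, mem_range] at hp; omega
  · rintro ⟨i, j⟩ hp
    simp only [mem_sigma, mem_univ, mem_Ioi, true_and] at hp
    simp only [mem_sigma, mem_range]
    exact ⟨j.2, hp⟩
  · rintro ⟨j, i⟩ hp
    simp only [mem_sigma, mem_range] at hp
    simp [hp.2]
  · simp
  · simp
  · simp

/-- This matches the power of `q` in the pattern sum with the one extracted from the product of
differences, so that the two cancel in MacMahon's formula. -/
lemma sum_triangle_eq_sum_range (n : ℕ) (f : ℕ → ℕ) :
    ∑ p ∈ triangle n, f p.1 = ∑ j ∈ range (n + 1), ∑ i ∈ range j, f i := by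
  rw [sum_sigma']
  refine sum_bij' (fun p _ => ⟨n - p.2, p.1⟩) (fun p _ => (p.2, n - p.1)) ?_ ?_ ?_ ?_ ?_
  · intro p hp
    simp only [mem_triangle, mem_sigma, mem_range] at hp ⊢
    omega
  · rintro ⟨j, i⟩ hp
    simp only [mem_triangle, mem_sigma, mem_range] at hp ⊢
    omega
  · rintro ⟨x, y⟩ hp
    simp only [mem_triangle] at hp
    simp only [Prod.mk.injEq, true_and]
    omega
  · rintro ⟨j, i⟩ hp
    simp only [mem_sigma, mem_range] at hp
    simp only [Sigma.mk.injEq, heq_eq_eq, and_true]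
    omega
  · simp

variable {K : Type*} [Field K]

/-- **MacMahon's formula** for the generating function of plane partitions in a box. -/
theorem sum_planePartitions_pow (q : K) (hq : q ≠ 0) (a b c : ℕ+)
    (h1 : ∀ k : ℕ, 0 < k → k < a + b → q ^ k ≠ 1) :
    (∑ ρ ∈ planePartitions a b c, q ^ #ρ) =
      ∏ p ∈ range a ×ˢ range b, (q ^ (p.1 + p.2 + 1 + c) - 1) / (q ^ (p.1 + p.2 + 1) - 1) := by
  have ha := a.pos
  have hb := b.pos
  have hN : (a : ℕ) + b - 1 + 1 = a + b := by omega
  have hdet := det_vandermonde_boxExponents q a b c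
  have e1 := det_vandermonde_eq_prod_range ((a : ℕ) + b - 1 + 1)
    fun i => q ^ (i + if (b : ℕ) ≤ i then (c : ℕ) else 0)
  change (Matrix.vandermonde fun i => q ^ boxExponents a b c i).det = _ at e1
  rw [e1, sum_triangle_eq_sum_range _ fun i => i + if (b : ℕ) ≤ i then (c : ℕ) else 0, hN] at hdet
  set P := (range ((a : ℕ) + b)).sigma fun j => range j with hP
  set N := ∑ ρ ∈ planePartitions a b c, q ^ #ρ
  -- The smaller power of `q` is pulled out of each difference. The gap of exponents grows by `c`
  -- exactly for pairs straddling `b`.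
  have e2 : ∏ j ∈ range ((a : ℕ) + b), ∏ i ∈ range j, ((q ^ (j + if (b : ℕ) ≤ j then (c : ℕ) else 0)) -
      q ^ (i + if (b : ℕ) ≤ i then (c : ℕ) else 0)) =
      (∏ p ∈ P, (q ^ (p.1 - p.2 + if p.2 < b ∧ b ≤ p.1 then (c : ℕ) else 0) - 1)) *
      q ^ (∑ j ∈ range ((a : ℕ) + b), ∑ i ∈ range j, (i + if (b : ℕ) ≤ i then (c : ℕ) else 0)) := by
    rw [prod_sigma', sum_sigma', ← prod_pow_eq_pow_sum, ← prod_mul_distrib]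
    refine prod_congr rfl fun p hp => ?_
    simp only [hP, mem_sigma, mem_range] at hp
    rw [sub_mul, one_mul, ← pow_add]
    congr 2
    split_ifs <;> omega
  have e3 : ∏ r ∈ range ((a : ℕ) + b), ∏ k ∈ range r, (q ^ (k + 1) - 1) =
      ∏ p ∈ P, (q ^ (p.1 - p.2) - 1) := by
    rw [hP, prod_sigma]
    refine prod_congr rfl fun r _ => ?_
    rw [← prod_range_reflect]
    refine prod_congr rfl fun k hk => ?_
    have := mem_range.1 hk
    rw [show r - 1 - k + 1 = r - k by omega]
  rw [e2, e3, mul_comm (q ^ _) N, ← mul_assoc] at hdet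
  have hdet' := mul_right_cancel₀ (pow_ne_zero _ hq) hdet
  -- Pairs on the same side of `b` give equal factors on both sides and cancel; the straddling pairs
  -- form the `a × b` product.
  rw [← prod_filter_mul_prod_filter_not P (fun p => p.2 < b ∧ b ≤ p.1),
    ← prod_filter_mul_prod_filter_not P (fun p => p.2 < b ∧ b ≤ p.1) fun p => q ^ (p.1 - p.2) - 1,
    mul_right_comm] at hdet'
  have hne : ∀ p ∈ P, q ^ (p.1 - p.2) - 1 ≠ 0 := fun p hp => by
    simp only [hP, mem_sigma, mem_range] at hp
    exact sub_ne_zero.2 (h1 _ (by omega) (by omega))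
  rw [prod_congr rfl (s₁ := P.filter fun p => ¬ (p.2 < (b : ℕ) ∧ (b : ℕ) ≤ p.1))
    (g := fun p => q ^ (p.1 - p.2) - 1) fun p hp => by rw [if_neg (mem_filter.1 hp).2, add_zero]]
    at hdet'
  have hdet2 := mul_right_cancel₀ (prod_ne_zero_iff.2 fun p hp => hne p (mem_filter.1 hp).1) hdet'
  rw [mul_comm, ← div_eq_iff (prod_ne_zero_iff.2 fun p hp => hne p (mem_filter.1 hp).1),
    ← prod_div_distrib] at hdet2
  rw [← hdet2]
  symm
  refine prod_bij' (fun p _ => ⟨b + p.1, b - 1 - p.2⟩) (fun p _ => (p.1 - b, b - 1 - p.2))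
    ?_ ?_ ?_ ?_ ?_
  · rintro ⟨i, j⟩ hp
    simp only [mem_product, mem_range, hP, mem_filter, mem_sigma] at hp ⊢
    omega
  · rintro ⟨i, j⟩ hp
    simp only [mem_product, mem_range, hP, mem_filter, mem_sigma] at hp ⊢
    omega
  · rintro ⟨i, j⟩ hp
    simp only [mem_product, mem_range, Prod.mk.injEq] at hp ⊢
    omega
  · rintro ⟨i, j⟩ hp
    simp only [mem_range, hP, mem_filter, mem_sigma] at hp
    simp only [Sigma.mk.injEq, heq_eq_eq]
    omega
  · rintro ⟨i, j⟩ hp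
    simp only [mem_product, mem_range] at hp
    rw [if_pos (by simp only; omega)]
    congr 3 <;> (congr 1; simp only; omega)

end MacMahon

/-! ### Convergence in the Lévy metric -/

section Levy

open Filter Topology

namespace RealLaw

/-- The Lévy condition is the Lévy–Prokhorov condition tested on half-lines only, the thickening of
a half-line lying in a shifted half-line. -/
lemma mem_levySet_of_levyProkhorovEDist_lt {μ ν : RealLaw} {ε : ℝ} (hε : 0 < ε)
    (h : levyProkhorovEDist (μ.law : Measure ℝ) (ν.law : Measure ℝ) < ENNReal.ofReal ε) :
    ε ∈ levySet μ ν := by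
  have key : ∀ (P Q : Measure ℝ) [IsProbabilityMeasure P] [IsProbabilityMeasure Q] (x : ℝ),
      P (Set.Iic x) ≤ Q (Metric.thickening (ENNReal.ofReal ε).toReal (Set.Iic x)) +
        ENNReal.ofReal ε → cdf P x ≤ cdf Q (x + ε) + ε := by
    intro P Q _ _ x hx
    rw [cdf_eq_real, cdf_eq_real]
    have hsub : Metric.thickening (ENNReal.ofReal ε).toReal (Set.Iic x) ⊆ Set.Iic (x + ε) := by
      intro y hy
      obtain ⟨z, hz, hyz⟩ := Metric.mem_thickening_iff.1 hy
      rw [ENNReal.toReal_ofReal hε.le, Real.dist_eq] at hyz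
      have h1 := (abs_lt.1 hyz).2
      have h2 : z ≤ x := hz
      change y ≤ x + ε
      linarith
    have h1 := hx.trans (add_le_add_left (measure_mono hsub) _)
    have h2 := ENNReal.toReal_mono
      (ENNReal.add_ne_top.2 ⟨measure_ne_top _ _, ENNReal.ofReal_ne_top⟩) h1
    rwa [ENNReal.toReal_add (measure_ne_top _ _) ENNReal.ofReal_ne_top,
      ENNReal.toReal_ofReal hε.le] at h2
  refine ⟨hε, fun x => ⟨?_, ?_⟩⟩
  · have := key _ _ (x - ε) (left_measure_le_of_levyProkhorovEDist_lt h measurableSet_Iic)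
    rw [sub_add_cancel] at this
    unfold distFun
    linarith
  · exact key _ _ x (right_measure_le_of_levyProkhorovEDist_lt h measurableSet_Iic)

/-- Convergence in distribution implies convergence in the Lévy metric. -/
lemma tendsto_of_tendsto_law {u : ℕ → RealLaw} {μ : RealLaw}
    (h : Tendsto (fun n => (u n).law) atTop (𝓝 μ.law)) : Tendsto u atTop (𝓝 μ) := by
  have h1 := (LevyProkhorov.probabilityMeasureHomeomorph (Ω := ℝ)).continuous.continuousAt.tendsto.comp h
  rw [Metric.tendsto_atTop]
  intro ε hε
  obtain ⟨N, hN⟩ := (EMetric.tendsto_atTop.1 h1) (ENNReal.ofReal (ε / 2)) (by simpa using hε)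
  refine ⟨N, fun n hn => ?_⟩
  have := mem_levySet_of_levyProkhorovEDist_lt (μ := u n) (ν := μ) (half_pos hε) (hN n hn)
  exact (csInf_le (levySet_bddBelow _ _) this).trans_lt (half_lt_self hε)

lemma tendsto_of_tendsto_charFun {u : ℕ → RealLaw} {μ : RealLaw}
    (h : ∀ t, Tendsto (fun n => charFun ((u n).law : Measure ℝ) t) atTop
      (𝓝 (charFun (μ.law : Measure ℝ) t))) : Tendsto u atTop (𝓝 μ) :=
  tendsto_of_tendsto_law (ProbabilityMeasure.tendsto_of_tendsto_charFun h)

lemma charFun_standardize (μ : RealLaw) (t : ℝ) :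
    charFun (μ.standardize.law : Measure ℝ) t =
      Complex.exp (-(t / √(variance id (μ.law : Measure ℝ)) *
        ∫ y, y ∂(μ.law : Measure ℝ) : ℝ) * Complex.I) *
        charFun (μ.law : Measure ℝ) (t / √(variance id (μ.law : Measure ℝ))) := by
  set m := ∫ y, y ∂(μ.law : Measure ℝ)
  set s := √(variance id (μ.law : Measure ℝ))
  rw [charFun_apply_real, charFun_apply_real]
  change ∫ x, _ ∂((μ.law : Measure ℝ).map fun x : ℝ => (x - m) / s) = _
  rw [integral_map (by fun_prop) (by fun_prop), ← integral_const_mul]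
  refine integral_congr_ae (Eventually.of_forall fun x => ?_)
  dsimp only
  rw [← Complex.exp_add]
  congr 1
  push_cast
  ring

/-- A law whose characteristic function is `exp (i m t) (1 - v t² / 2 + o(t²))` near zero
has mean `m` and variance `v`. -/
lemma integral_eq_and_variance_eq (μ : RealLaw) (hμ : MemLp id 2 (μ.law : Measure ℝ)) {m v : ℝ}
    {g : ℝ → ℝ} (hg : Tendsto (fun s => (g s - 1) / s ^ 2) (𝓝[≠] 0) (𝓝 (-(v / 2))))
    (h : ∀ᶠ s in 𝓝[≠] 0, charFun (μ.law : Measure ℝ) s =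
      Complex.exp ((s * m : ℝ) * Complex.I) * (g s : ℂ)) :
    ∫ y, y ∂(μ.law : Measure ℝ) = m ∧ variance id (μ.law : Measure ℝ) = v := by
  set P := (μ.law : Measure ℝ)
  have hX : AEMeasurable (fun x : ℝ => x - m) P := by fun_prop
  have hmap : IsProbabilityMeasure (P.map fun x : ℝ => x - m) := Measure.isProbabilityMeasure_map hX
  have hL : MemLp id 2 (P.map fun x : ℝ => x - m) := by
    rw [memLp_map_measure_iff (by fun_prop) hX]
    exact hμ.sub (memLp_const m)
  have hint : Integrable (fun x : ℝ => x) P := hμ.integrable one_le_two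
  have hT : (fun t => charFun (P.map fun x : ℝ => x - m) t -
      (1 + (P[fun x : ℝ => x - m] : ℝ) * t * Complex.I -
        (P[(fun x : ℝ => x - m) ^ 2] : ℝ) * t ^ 2 / 2)) =o[𝓝 0] fun t : ℝ => t ^ 2 := by
    simp_rw [← taylorWithinEval_charFun_two_zero hX hL]
    convert! taylor_isLittleO_univ (n := 2) (x₀ := (0 : ℝ)) (contDiff_charFun hL)
    simp
  set E1 := P[fun x : ℝ => x - m]
  set E2 := P[(fun x : ℝ => x - m) ^ 2]
  have hchar : ∀ᶠ s in 𝓝[≠] (0 : ℝ), charFun (P.map fun x : ℝ => x - m) s = g s := by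
    filter_upwards [h] with s hs
    rw [charFun_apply_real, integral_map hX (by fun_prop)]
    have : ∀ x : ℝ, Complex.exp (s * (x - m : ℝ) * Complex.I) =
        Complex.exp (-((s * m : ℝ) * Complex.I)) * Complex.exp (s * x * Complex.I) := fun x => by
      rw [← Complex.exp_add]; congr 1; push_cast; ring
    simp_rw [this]
    rw [integral_const_mul, ← charFun_apply_real, hs, ← mul_assoc, ← Complex.exp_add,
      neg_add_cancel, Complex.exp_zero, one_mul]
  have hlim : Tendsto (fun s : ℝ => (charFun (P.map fun x : ℝ => x - m) s -
      (1 + (E1 : ℂ) * s * Complex.I - (E2 : ℂ) * s ^ 2 / 2)) / ((s ^ 2 : ℝ) : ℂ)) (𝓝[≠] 0) (𝓝 0) := by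
    have := (hT.mono (nhdsWithin_le_nhds (s := {(0 : ℝ)}ᶜ))).norm_left.tendsto_div_nhds_zero
    rw [tendsto_zero_iff_norm_tendsto_zero]
    refine this.congr fun s => ?_
    rw [norm_div, Complex.norm_real, Real.norm_of_nonneg (sq_nonneg s)]
  -- After centering, `g` is real: comparing with the Taylor polynomial, the real part determines
  -- the second moment and the imaginary part forces the centered mean to vanish.
  have hre := (Complex.continuous_re.tendsto _).comp hlim
  have him := (Complex.continuous_im.tendsto _).comp hlim
  have hne : ∀ᶠ s : ℝ in 𝓝[≠] 0, s ≠ 0 := self_mem_nhdsWithin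
  have hre' : Tendsto (fun s => (g s - 1) / s ^ 2 + E2 / 2) (𝓝[≠] 0) (𝓝 0) := by
    refine hre.congr' ?_
    filter_upwards [hchar, hne] with s hs h0
    rw [Function.comp_apply, hs, Complex.div_ofReal_re]
    have : ((g s : ℂ) - (1 + (E1 : ℂ) * s * Complex.I - (E2 : ℂ) * s ^ 2 / 2)).re =
        g s - (1 - E2 * s ^ 2 / 2) := by
      have : (E2 : ℂ) * s ^ 2 / 2 = ((E2 * s ^ 2 / 2 : ℝ) : ℂ) := by push_cast; ring
      rw [this]
      generalize E2 * s ^ 2 / 2 = w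
      simp
    rw [this]; field_simp; ring
  have him' : Tendsto (fun s => -E1 / s) (𝓝[≠] 0) (𝓝 0) := by
    refine him.congr' ?_
    filter_upwards [hchar, hne] with s hs h0
    rw [Function.comp_apply, hs, Complex.div_ofReal_im]
    have : ((g s : ℂ) - (1 + (E1 : ℂ) * s * Complex.I - (E2 : ℂ) * s ^ 2 / 2)).im =
        - (E1 * s) := by
      have : (E2 : ℂ) * s ^ 2 / 2 = ((E2 * s ^ 2 / 2 : ℝ) : ℂ) := by push_cast; ring
      rw [this]
      generalize E2 * s ^ 2 / 2 = w
      simp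
    rw [this]; field_simp
  have hE2 : E2 = v := by
    have := tendsto_nhds_unique (hg.add_const (E2 / 2)) hre'
    linarith
  have hE1 : E1 = 0 := by
    have h1 : Tendsto (fun s : ℝ => s) (𝓝[≠] 0) (𝓝 0) := nhdsWithin_le_nhds
    have h2 := him'.mul h1
    rw [zero_mul] at h2
    have h3 : Tendsto (fun s : ℝ => -E1 / s * s) (𝓝[≠] 0) (𝓝 (-E1)) := by
      refine tendsto_const_nhds.congr' ?_
      filter_upwards [hne] with s h0
      rw [div_mul_cancel₀ _ h0]
    have := tendsto_nhds_unique h2 h3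
    linarith
  have hmean : ∫ y, y ∂P = m := by
    have : E1 = ∫ y, y ∂P - m := by
      simp only [E1]
      rw [integral_sub hint (integrable_const _)]; simp
    linarith
  refine ⟨hmean, ?_⟩
  rw [variance_eq_integral aemeasurable_id, ← hE2]
  simp only [id, hmean, E2, Pi.pow_apply]

end RealLaw

end Levy

/-! ### Expansions of the cardinal sine and Gaussian limits of its products -/

section Sinc

open Filter Topology Real Finset

lemma tendsto_sinc_sub_one_div_sq :
    Tendsto (fun x => (sinc x - 1) / x ^ 2) (𝓝[≠] 0) (𝓝 (-(1 / 6))) := by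
  rw [tendsto_iff_norm_sub_tendsto_zero]
  have h0 : Tendsto (fun x : ℝ => |x|) (𝓝[≠] 0) (𝓝 0) := by
    have : Tendsto (fun x : ℝ => |x|) (𝓝 0) (𝓝 0) := by simpa using (continuous_abs.tendsto (0 : ℝ))
    exact this.mono_left nhdsWithin_le_nhds
  refine squeeze_zero' (Eventually.of_forall fun _ => norm_nonneg _) ?_ h0
  have h1 : ∀ᶠ x : ℝ in 𝓝[≠] 0, |x| ≤ 1 := (h0.eventually (eventually_le_nhds one_pos))
  filter_upwards [h1, self_mem_nhdsWithin] with x hx hx0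
  have hx0 : x ≠ 0 := hx0
  have hb := Real.sin_bound hx
  have e : (sinc x - 1) / x ^ 2 - -(1 / 6) = (sin x - (x - x ^ 3 / 6)) / x ^ 3 := by
    rw [sinc_of_ne_zero hx0]; field_simp; ring
  rw [e, Real.norm_eq_abs, abs_div, div_le_iff₀ (by positivity), abs_pow]
  have h4 : 0 ≤ |x| ^ 4 := by positivity
  calc _ ≤ |x| ^ 5 / 100 := hb
    _ = |x| ^ 4 * |x| / 100 := by ring
    _ ≤ |x| ^ 4 := by nlinarith [abs_nonneg x]
    _ = _ := by ring

/-- `f = 1 - α s² + o(s²)` at zero. -/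
def HasQuadraticExpansion (f : ℝ → ℝ) (α : ℝ) : Prop :=
  Tendsto (fun s => (f s - 1) / s ^ 2) (𝓝[≠] 0) (𝓝 (-α))

namespace HasQuadraticExpansion

variable {f g : ℝ → ℝ} {α β : ℝ}

lemma tendsto_one (h : HasQuadraticExpansion f α) : Tendsto f (𝓝[≠] 0) (𝓝 1) := by
  have h1 : Tendsto (fun s : ℝ => s ^ 2) (𝓝[≠] 0) (𝓝 0) := by
    have : Tendsto (fun s : ℝ => s ^ 2) (𝓝 0) (𝓝 (0 ^ 2)) := (continuous_pow 2).tendsto 0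
    rw [zero_pow two_ne_zero] at this
    exact this.mono_left nhdsWithin_le_nhds
  have h2 := (Tendsto.mul h h1).add_const 1
  rw [mul_zero, zero_add] at h2
  refine h2.congr' ?_
  filter_upwards [self_mem_nhdsWithin] with s hs
  have hs : s ≠ 0 := hs
  field_simp
  ring

lemma mul (hf : HasQuadraticExpansion f α) (hg : HasQuadraticExpansion g β) :
    HasQuadraticExpansion (fun s => f s * g s) (α + β) := by
  have := (Tendsto.mul hf hg.tendsto_one).add hg
  unfold HasQuadraticExpansion
  convert this using 2
  · ring
  · ring

lemma inv (hf : HasQuadraticExpansion f α) : HasQuadraticExpansion (fun s => (f s)⁻¹) (-α) := by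
  have h1 := hf.tendsto_one
  have := (Tendsto.div hf h1 one_ne_zero).neg
  rw [div_one] at this
  refine this.congr' ?_
  filter_upwards [h1.eventually_ne one_ne_zero, self_mem_nhdsWithin] with s hs h0
  have h0 : s ≠ 0 := h0
  simp only [Pi.div_apply]
  field_simp
  ring

lemma prod {ι : Type*} (S : Finset ι) {f : ι → ℝ → ℝ} {α : ι → ℝ}
    (h : ∀ i ∈ S, HasQuadraticExpansion (f i) (α i)) :
    HasQuadraticExpansion (fun s => ∏ i ∈ S, f i s) (∑ i ∈ S, α i) := by
  classical
  induction S using Finset.induction_on with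
  | empty => simp [HasQuadraticExpansion]
  | insert i S hi ih =>
    simp only [prod_insert hi, sum_insert hi]
    exact (h i (mem_insert_self _ _)).mul (ih fun j hj => h j (mem_insert_of_mem hj))

lemma sinc_mul {k : ℝ} (hk : k ≠ 0) : HasQuadraticExpansion (fun s => sinc (k * s)) (k ^ 2 / 6) := by
  have h1 : Tendsto (fun s : ℝ => k * s) (𝓝[≠] 0) (𝓝[≠] 0) := by
    refine tendsto_nhdsWithin_iff.2 ⟨?_, ?_⟩
    · have : Tendsto (fun s : ℝ => k * s) (𝓝 0) (𝓝 (k * 0)) := (continuous_const_mul k).tendsto 0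
      rw [mul_zero] at this
      exact this.mono_left nhdsWithin_le_nhds
    · filter_upwards [self_mem_nhdsWithin] with s hs
      exact mul_ne_zero hk hs
  have := (tendsto_sinc_sub_one_div_sq.comp h1).mul_const (k ^ 2)
  unfold HasQuadraticExpansion
  convert this.congr' ?_ using 2
  · ring
  filter_upwards [self_mem_nhdsWithin] with s hs
  have hs : s ≠ 0 := hs
  simp only [Function.comp_apply]
  field_simp

end HasQuadraticExpansion

/-- `log (sinc x) = - x² / 6 + o(x²)`. -/
lemma abs_log_sinc_add_le {ε : ℝ} (hε : 0 < ε) :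
    ∃ δ > 0, ∀ x, |x| < δ → 0 < sinc x ∧ |log (sinc x) + x ^ 2 / 6| ≤ ε * x ^ 2 := by
  have hlog : Tendsto (fun y : ℝ => log y / (y - 1)) (𝓝[≠] 1) (𝓝 1) := by
    have := (hasDerivAt_log (one_ne_zero (α := ℝ))).tendsto_slope
    simp only [inv_one] at this
    refine this.congr fun y => ?_
    rw [slope_def_field, log_one, sub_zero]
  have hs := tendsto_sinc_sub_one_div_sq
  have hcont : Tendsto sinc (𝓝 0) (𝓝 1) := by simpa using continuous_sinc.tendsto 0
  have hs1 : Tendsto sinc (𝓝[≠] 0) (𝓝[≠] 1) := by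
    refine tendsto_nhdsWithin_iff.2 ⟨hcont.mono_left nhdsWithin_le_nhds, ?_⟩
    -- If `sinc x = 1` the quotient would be zero, which is excluded near `0` because its limit is
    -- not zero.
    filter_upwards [hs.eventually_ne (show -(1 / 6 : ℝ) ≠ 0 by norm_num)] with x hx h1
    simp only [Set.mem_singleton_iff] at h1
    exact hx (by rw [h1]; simp)
  have h := (hlog.comp hs1).mul hs
  rw [one_mul] at h
  have h' : ∀ᶠ x in 𝓝[≠] (0 : ℝ), |log (sinc x) + x ^ 2 / 6| ≤ ε * x ^ 2 := by
    have hclose := (Metric.tendsto_nhds.1 h) ε hε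
    filter_upwards [hclose, self_mem_nhdsWithin, hs1.eventually self_mem_nhdsWithin] with x hx h0 h1
    have h0 : x ≠ 0 := h0
    have h1 : sinc x ≠ 1 := h1
    have h1' : sinc x - 1 ≠ 0 := sub_ne_zero.2 h1
    rw [Real.dist_eq, Function.comp_apply] at hx
    have e : log (sinc x) + x ^ 2 / 6 =
        (log (sinc x) / (sinc x - 1) * ((sinc x - 1) / x ^ 2) - -(1 / 6)) * x ^ 2 := by
      field_simp; ring
    rw [e, abs_mul, abs_of_nonneg (sq_nonneg x)]
    exact mul_le_mul_of_nonneg_right hx.le (sq_nonneg x)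
  have h'' : ∀ᶠ x in 𝓝 (0 : ℝ), |log (sinc x) + x ^ 2 / 6| ≤ ε * x ^ 2 := by
    rw [eventually_nhdsWithin_iff] at h'
    filter_upwards [h'] with x hx
    by_cases h0 : x = 0
    · simp [h0]
    · exact hx h0
  obtain ⟨δ, hδ, H⟩ := Metric.eventually_nhds_iff.1
    ((hcont.eventually (eventually_gt_nhds one_pos)).and h'')
  exact ⟨δ, hδ, fun x hx => H (by simpa [Real.dist_eq] using hx)⟩

/-- A product of ratios of cardinal sines at uniformly small arguments is close to a Gaussian. -/
lemma tendsto_prod_sinc_div_sinc {ι : Type*} {S : ℕ → Finset ι} {u v : ℕ → ι → ℝ} {δ : ℕ → ℝ}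
    (hδ : Tendsto δ atTop (𝓝 0)) (hu : ∀ n, ∀ i ∈ S n, |u n i| ≤ δ n)
    (hv : ∀ n, ∀ i ∈ S n, |v n i| ≤ δ n) {C t : ℝ}
    (hC : ∀ n, ∑ i ∈ S n, (u n i ^ 2 + v n i ^ 2) ≤ C)
    (ht : ∀ n, ∑ i ∈ S n, (u n i ^ 2 - v n i ^ 2) = 3 * t ^ 2) :
    Tendsto (fun n => ∏ i ∈ S n, sinc (u n i) / sinc (v n i)) atTop (𝓝 (exp (-(t ^ 2 / 2)))) := by
  have hsum : Tendsto (fun n => ∑ i ∈ S n, (log (sinc (u n i)) - log (sinc (v n i)))) atTop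
      (𝓝 (-(t ^ 2 / 2))) := by
    rw [Metric.tendsto_nhds]
    intro ε hε
    have hC0 : 0 ≤ C := (sum_nonneg fun i _ => by positivity).trans (hC 0)
    -- The squares sum to at most `C`; dividing by `C + 1` makes the total error strictly below `ε`
    -- and allows `C = 0`.
    obtain ⟨η, hη, H⟩ := abs_log_sinc_add_le (show 0 < ε / (C + 1) by positivity)
    filter_upwards [hδ.eventually (gt_mem_nhds hη)] with n hn
    rw [Real.dist_eq]
    have e : -(t ^ 2 / 2) = -∑ i ∈ S n, (u n i ^ 2 - v n i ^ 2) / 6 := by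
      rw [← sum_div, ht]; ring
    rw [e, sub_neg_eq_add, ← sum_add_distrib]
    calc _ ≤ ∑ i ∈ S n, |log (sinc (u n i)) - log (sinc (v n i)) + (u n i ^ 2 - v n i ^ 2) / 6| :=
          abs_sum_le_sum_abs _ _
      _ ≤ ∑ i ∈ S n, ε / (C + 1) * (u n i ^ 2 + v n i ^ 2) := by
          refine sum_le_sum fun i hi => ?_
          have h1 := (H _ ((hu n i hi).trans_lt hn)).2
          have h2 := (H _ ((hv n i hi).trans_lt hn)).2
          rw [abs_le] at h1 h2 ⊢
          constructor <;> linarith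
      _ ≤ ε / (C + 1) * C := by
          rw [← mul_sum]; exact mul_le_mul_of_nonneg_left (hC n) (by positivity)
      _ < ε := by
          rw [div_mul_eq_mul_div, div_lt_iff₀ (by positivity)]; nlinarith
  refine ((continuous_exp.tendsto _).comp hsum).congr' ?_
  obtain ⟨η, hη, H⟩ := abs_log_sinc_add_le one_pos
  filter_upwards [hδ.eventually (gt_mem_nhds hη)] with n hn
  rw [Function.comp_apply, exp_sum]
  refine prod_congr rfl fun i hi => ?_
  rw [exp_sub, exp_log (H _ ((hu n i hi).trans_lt hn)).1, exp_log (H _ ((hv n i hi).trans_lt hn)).1]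

end Sinc

/-! ### Characteristic functions of the standardized laws -/

section Laws

open Filter Topology Real Finset

namespace RealLaw

/-- The standardization of a law with characteristic function `exp (i m s) g(s)`, where
`g = 1 - v s² / 2 + o(s²)` at zero. -/
lemma charFun_standardize_of_eq (μ : RealLaw) (hμ : MemLp id 2 (μ.law : Measure ℝ)) {m v r : ℝ}
    (hr : 0 < r) {g : ℝ → ℝ} (hg : HasQuadraticExpansion g (v / 2))
    (h : ∀ s, |s| < r → charFun (μ.law : Measure ℝ) s =
      Complex.exp ((s * m : ℝ) * Complex.I) * (g s : ℂ)) {t : ℝ} (ht : |t / √v| < r) :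
    charFun (μ.standardize.law : Measure ℝ) t = g (t / √v) := by
  obtain ⟨h1, h2⟩ := μ.integral_eq_and_variance_eq hμ hg (by
    refine nhdsWithin_le_nhds ?_
    filter_upwards [Metric.ball_mem_nhds (0 : ℝ) hr] with s hs
    exact h s (by simpa [Real.dist_eq] using hs))
  rw [charFun_standardize, h1, h2, h _ ht, ← mul_assoc, ← Complex.exp_add, ← add_mul,
    neg_add_cancel, zero_mul, Complex.exp_zero, one_mul]

end RealLaw

lemma charFun_uniformUnitLaw (t : ℝ) :
    charFun uniformUnitLaw t = Complex.exp ((t / 2 : ℝ) * Complex.I) * (sinc (t / 2) : ℂ) := by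
  rw [charFun_apply_real, uniformUnitLaw, integral_Icc_eq_integral_Ioc,
    ← intervalIntegral.integral_of_le zero_le_one]
  have h := integral_exp_mul_I_eq_sinc (t / 2)
  by_cases ht : t = 0
  · simp [ht]
  have h1 : ∫ x in (0 : ℝ)..1, Complex.exp (t * x * Complex.I) =
      Complex.exp ((t / 2 : ℝ) * Complex.I) *
        ∫ x in (0 : ℝ)..1, Complex.exp ((t * x - t / 2 : ℝ) * Complex.I) := by
    rw [← intervalIntegral.integral_const_mul]
    refine intervalIntegral.integral_congr fun x _ => ?_
    rw [← Complex.exp_add]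
    congr 1
    push_cast
    ring
  rw [h1]
  congr 1
  have h2 := intervalIntegral.integral_comp_mul_sub (a := 0) (b := 1)
    (fun x : ℝ => Complex.exp (x * Complex.I)) ht (t / 2)
  rw [h2, show t * 0 - t / 2 = -(t / 2) by ring, show t * 1 - t / 2 = t / 2 by ring, h,
    Complex.real_smul]
  have : (t : ℂ) ≠ 0 := by exact_mod_cast ht
  push_cast
  field_simp

lemma charFun_irwinHall (M : ℕ) (t : ℝ) :
    charFun ((irwinHall M).law : Measure ℝ) t =
      Complex.exp ((t * (M / 2) : ℝ) * Complex.I) * ((sinc (1 / 2 * t) ^ M : ℝ) : ℂ) := by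
  rw [charFun_apply_real]
  change ∫ x, _ ∂((Measure.pi fun _ : Fin M => uniformUnitLaw).map
    fun x : Fin M → ℝ => ∑ i, x i) = _
  rw [integral_map (by fun_prop) (by fun_prop)]
  have : ∀ x : Fin M → ℝ, Complex.exp (t * (∑ i, x i : ℝ) * Complex.I) =
      ∏ i, Complex.exp (t * x i * Complex.I) := fun x => by
    rw [← Complex.exp_sum]
    push_cast
    rw [Finset.mul_sum, Finset.sum_mul]
  simp_rw [this]
  rw [integral_fintype_prod_eq_prod (𝕜 := ℂ) (E := fun _ : Fin M => ℝ)
    (f := fun _ x => Complex.exp (t * x * Complex.I))]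
  simp_rw [← charFun_apply_real, charFun_uniformUnitLaw]
  rw [prod_const, card_univ, Fintype.card_fin, mul_pow, ← Complex.exp_nat_mul]
  congr 1
  · congr 1; push_cast; ring
  · rw [show t / 2 = 1 / 2 * t by ring]; push_cast; rfl

lemma uniformUnitLaw_memLp_id : MemLp id 2 uniformUnitLaw := by
  refine MemLp.of_bound (by fun_prop) 1 ?_
  filter_upwards [ae_restrict_mem measurableSet_Icc] with x hx
  rw [id, Real.norm_of_nonneg hx.1]
  exact hx.2

lemma irwinHall_memLp_id (M : ℕ) : MemLp id 2 ((irwinHall M).law : Measure ℝ) := by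
  change MemLp id 2 ((Measure.pi fun _ : Fin M => uniformUnitLaw).map
    fun x : Fin M → ℝ => ∑ i, x i)
  rw [memLp_map_measure_iff (by fun_prop) (by fun_prop)]
  change MemLp (fun x : Fin M → ℝ => ∑ i, x i) 2 _
  refine memLp_finsetSum _ fun i _ => ?_
  exact uniformUnitLaw_memLp_id.comp_measurePreserving (measurePreserving_eval _ i)

lemma charFun_standardize_irwinHall (M : ℕ) (t : ℝ) :
    charFun ((irwinHall M).standardize.law : Measure ℝ) t =
      (sinc (1 / 2 * (t / √(M / 12))) ^ M : ℝ) := by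
  have hg : HasQuadraticExpansion (fun s => sinc (1 / 2 * s) ^ M) ((M / 12 : ℝ) / 2) := by
    have := HasQuadraticExpansion.prod (range M) (f := fun _ s => sinc (1 / 2 * s))
      fun _ _ => HasQuadraticExpansion.sinc_mul (show (1 / 2 : ℝ) ≠ 0 by norm_num)
    simp only [prod_const, card_range, sum_const, nsmul_eq_mul] at this
    convert this using 1
    ring
  exact (irwinHall M).charFun_standardize_of_eq (irwinHall_memLp_id M)
    -- The formula is valid for every `s`, so any radius beyond the point of evaluation serves.
    (r := |t / √(M / 12)| + 1) (by positivity) hg (fun s _ => charFun_irwinHall M s) (lt_add_one _)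

lemma charFun_stdNormalLaw (t : ℝ) :
    charFun (stdNormalLaw.law : Measure ℝ) t = (exp (-(t ^ 2 / 2)) : ℝ) := by
  change charFun (gaussianReal 0 1) t = _
  rw [charFun_gaussianReal]
  push_cast
  congr 1
  simp

lemma planePartitionSizeLaw_eq_sum_dirac (a b c : ℕ+) :
    ((planePartitionSizeLaw a b c).law : Measure ℝ) = (#(planePartitions a b c) : ENNReal)⁻¹ •
      ∑ ρ ∈ planePartitions a b c, Measure.dirac (#ρ : ℝ) := by
  classical
  let _ : MeasurableSpace (Finset (ℕ+ × ℕ+ × ℕ+)) := ⊤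
  ext s hs
  change ((PMF.uniformOfFinset _ _).map _).toMeasure s = _
  rw [PMF.toMeasure_map_apply _ _ _ measurable_from_top hs,
    PMF.toMeasure_uniformOfFinset_apply _ _ (MeasurableSet.of_discrete), Measure.smul_apply,
    Measure.finsetSum_apply, smul_eq_mul, ENNReal.div_eq_inv_mul, card_filter]
  congr 1
  push_cast
  refine sum_congr rfl fun ρ _ => ?_
  rw [Measure.dirac_apply' _ hs, Set.indicator_apply]
  rfl

lemma integral_planePartitionSizeLaw (a b c : ℕ+) (f : ℝ → ℂ) :
    ∫ x, f x ∂((planePartitionSizeLaw a b c).law : Measure ℝ) =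
      (#(planePartitions a b c) : ℂ)⁻¹ * ∑ ρ ∈ planePartitions a b c, f #ρ := by
  rw [planePartitionSizeLaw_eq_sum_dirac, integral_smul_measure,
    integral_finsetSum_measure fun _ _ => integrable_dirac (by finiteness)]
  simp [integral_dirac]

lemma planePartitionSizeLaw_memLp_id (a b c : ℕ+) :
    MemLp id 2 ((planePartitionSizeLaw a b c).law : Measure ℝ) := by
  rw [planePartitionSizeLaw_eq_sum_dirac]
  refine MemLp.smul_measure ?_ (by simpa using (planePartitions_nonempty a b c).ne_empty)
  rw [memLp_two_iff_integrable_sq (by fun_prop), integrable_finsetSum_measure]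
  exact fun _ _ => integrable_dirac (by finiteness)

/-- Since `exp (i k s) - 1 = 2 i sin (k s / 2) exp (i k s / 2)`, each MacMahon factor splits into a
phase, which goes into the mean, and a real ratio. -/
lemma exp_sub_one_div_exp_sub_one (m n s : ℝ) (hm : m ≠ 0) (hn : n ≠ 0) (hs : s ≠ 0) :
    (Complex.exp ((m * s : ℝ) * Complex.I) - 1) / (Complex.exp ((n * s : ℝ) * Complex.I) - 1) =
      Complex.exp (((m - n) / 2 * s : ℝ) * Complex.I) *
        ((m / n * (sinc (m / 2 * s) / sinc (n / 2 * s)) : ℝ) : ℂ) := by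
  have key : ∀ k : ℝ, k ≠ 0 → Complex.exp ((k * s : ℝ) * Complex.I) - 1 =
      Complex.exp ((k / 2 * s : ℝ) * Complex.I) * (s * Complex.I) * ((k * sinc (k / 2 * s) : ℝ) : ℂ) := by
    intro k hk
    have h1 : k * sinc (k / 2 * s) * s = 2 * sin (k / 2 * s) := by
      rw [sinc_of_ne_zero (by positivity)]; field_simp
    have h2 : Complex.exp ((k * s : ℝ) * Complex.I) =
        Complex.exp ((k / 2 * s : ℝ) * Complex.I) * Complex.exp ((k / 2 * s : ℝ) * Complex.I) := by
      rw [← Complex.exp_add]; congr 1; push_cast; ring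
    have h3 : (1 : ℂ) =
        Complex.exp ((k / 2 * s : ℝ) * Complex.I) * Complex.exp (-(k / 2 * s : ℝ) * Complex.I) := by
      rw [← Complex.exp_add, neg_mul, add_neg_cancel, Complex.exp_zero]
    have h4 : Complex.exp ((k / 2 * s : ℝ) * Complex.I) - Complex.exp (-(k / 2 * s : ℝ) * Complex.I) =
        2 * (sin (k / 2 * s) : ℝ) * Complex.I := by
      rw [Complex.exp_mul_I, Complex.exp_mul_I, Complex.cos_neg, Complex.sin_neg, Complex.ofReal_sin]
      ring
    calc _ = Complex.exp ((k / 2 * s : ℝ) * Complex.I) *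
          (Complex.exp ((k / 2 * s : ℝ) * Complex.I) - Complex.exp (-(k / 2 * s : ℝ) * Complex.I)) := by
            rw [mul_sub, ← h3, ← h2]
      _ = _ := by
          rw [h4, mul_assoc, mul_assoc]
          congr 1
          rw [show (2 : ℂ) * ((sin (k / 2 * s) : ℝ) * Complex.I) =
            ((2 * sin (k / 2 * s) : ℝ) : ℂ) * Complex.I by push_cast; ring, ← h1]
          push_cast; ring
  rw [key m hm, key n hn]
  have h5 : Complex.exp ((m / 2 * s : ℝ) * Complex.I) = Complex.exp (((m - n) / 2 * s : ℝ) * Complex.I) *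
      Complex.exp ((n / 2 * s : ℝ) * Complex.I) := by
    rw [← Complex.exp_add]; congr 1; push_cast; ring
  rw [h5]
  have hsI : (s : ℂ) * Complex.I ≠ 0 := mul_ne_zero (by exact_mod_cast hs) Complex.I_ne_zero
  have hE := Complex.exp_ne_zero ((n / 2 * s : ℝ) * Complex.I)
  rw [mul_assoc _ _ ((s : ℂ) * Complex.I), mul_assoc, mul_div_assoc,
    mul_div_mul_left _ _ (mul_ne_zero hE hsI), ← Complex.ofReal_div, mul_div_mul_comm]

/-- The angle `k s` is nonzero and less than a full turn. This keeps the denominators in MacMahon's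
formula away from zero. -/
lemma exp_pow_ne_one {N : ℕ} {s : ℝ} (h0 : s ≠ 0) (hs : |s| * N < 2 * π) {k : ℕ} (hk : 0 < k)
    (hkN : k ≤ N) : Complex.exp (s * Complex.I) ^ k ≠ 1 := by
  rw [← Complex.exp_nat_mul, Ne, Complex.exp_eq_one_iff]
  rintro ⟨z, hz⟩
  have h1 : (k : ℝ) * s = z * (2 * π) := by
    have : ((k * s : ℝ) : ℂ) * Complex.I = ((z * (2 * π) : ℝ) : ℂ) * Complex.I := by
      push_cast; rw [mul_assoc, hz]; ring
    exact_mod_cast mul_right_cancel₀ Complex.I_ne_zero this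
  have hz0 : z ≠ 0 := by
    rintro rfl
    have : (k : ℝ) * s ≠ 0 := mul_ne_zero (by positivity) h0
    exact this (by rw [h1]; simp)
  have h2 : (1 : ℝ) ≤ |(z : ℝ)| := by exact_mod_cast Int.one_le_abs hz0
  have h3 : |(k : ℝ) * s| = |(z : ℝ)| * (2 * π) := by
    rw [h1, abs_mul, abs_of_pos (by positivity : 0 < 2 * π)]
  rw [abs_mul, Nat.abs_cast] at h3
  have h4 : (k : ℝ) * |s| ≤ |s| * N := by
    rw [mul_comm]; exact mul_le_mul_of_nonneg_left (by exact_mod_cast hkN) (abs_nonneg _)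
  nlinarith [pi_pos]

/-- The centered characteristic function of the size of a random plane partition. -/
def sincRatio (a b c : ℕ+) (s : ℝ) : ℝ :=
  ∏ p ∈ range a ×ˢ range b,
    sinc ((p.1 + p.2 + 1 + c) / 2 * s) / sinc ((p.1 + p.2 + 1) / 2 * s)

lemma sum_range_prod_add (a b : ℕ) :
    ∑ p ∈ range a ×ˢ range b, ((p.1 : ℝ) + p.2 + 1) = a * b * (a + b) / 2 := by
  have h : ∀ n : ℕ, ∑ i ∈ range n, (i : ℝ) = n * (n - 1) / 2 := fun n => by
    induction n with
    | zero => simp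
    | succ n ih => rw [sum_range_succ, ih]; push_cast; ring
  rw [sum_product]
  simp only [sum_add_distrib, sum_const, card_range, nsmul_eq_mul, h, ← mul_sum]
  ring

lemma sum_range_prod_sq_sub_sq (a b c : ℕ) :
    ∑ p ∈ range a ×ˢ range b, (((p.1 : ℝ) + p.2 + 1 + c) ^ 2 - ((p.1 : ℝ) + p.2 + 1) ^ 2) =
      (a * b * c * (a + b + c) : ℝ) := by
  have : ∀ p ∈ range a ×ˢ range b, (((p.1 : ℝ) + p.2 + 1 + c) ^ 2 - ((p.1 : ℝ) + p.2 + 1) ^ 2) =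
      2 * c * ((p.1 : ℝ) + p.2 + 1) + c ^ 2 := fun p _ => by ring
  rw [sum_congr rfl this, sum_add_distrib, ← mul_sum, sum_range_prod_add]
  simp only [sum_const, card_product, card_range, nsmul_eq_mul]
  push_cast
  ring

/-- A factor with numbers `m = n + c` above and `n` below contributes `(m² - n²) / 24`; summing
these produces half the variance. -/
lemma sincRatio_hasQuadraticExpansion (a b c : ℕ+) :
    HasQuadraticExpansion (sincRatio a b c) ((a * b * c * (a + b + c) / 12 : ℝ) / 2) := by
  have := HasQuadraticExpansion.prod (range a ×ˢ range b)
    (f := fun p s => sinc (((p.1 : ℝ) + p.2 + 1 + c) / 2 * s) * (sinc (((p.1 : ℝ) + p.2 + 1) / 2 * s))⁻¹)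
    fun p _ => (HasQuadraticExpansion.sinc_mul (by positivity)).mul
      (HasQuadraticExpansion.sinc_mul (by positivity)).inv
  simp only [← div_eq_mul_inv] at this
  unfold sincRatio
  convert this using 1
  rw [← sum_range_prod_sq_sub_sq, sum_div, sum_div]
  refine sum_congr rfl fun p _ => ?_
  ring

lemma charFun_planePartitionSizeLaw (a b c : ℕ+) {s : ℝ} (hs : |s| < 2 * π / (a + b)) :
    charFun ((planePartitionSizeLaw a b c).law : Measure ℝ) s =
      Complex.exp ((s * (a * b * c / 2) : ℝ) * Complex.I) * (sincRatio a b c s : ℂ) := by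
  set R : ℝ := ∏ p ∈ range a ×ˢ range b, ((p.1 : ℝ) + p.2 + 1 + c) / ((p.1 : ℝ) + p.2 + 1)
  set N := (#(planePartitions a b c) : ℝ)
  have hN : N ≠ 0 := by
    simpa [N] using (planePartitions_nonempty a b c).ne_empty
  have hgen : ∀ s : ℝ, s ≠ 0 → |s| < 2 * π / (a + b) →
      charFun ((planePartitionSizeLaw a b c).law : Measure ℝ) s =
        Complex.exp ((s * (a * b * c / 2) : ℝ) * Complex.I) *
          ((N⁻¹ * R * sincRatio a b c s : ℝ) : ℂ) := by
    intro s h0 hs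
    rw [lt_div_iff₀ (by positivity)] at hs
    have h1 := sum_planePartitions_pow (Complex.exp (s * Complex.I)) (Complex.exp_ne_zero _) a b c
      fun k hk hk' => exp_pow_ne_one h0 (N := a + b) (by push_cast; exact hs) hk hk'.le
    rw [charFun_apply_real, integral_planePartitionSizeLaw]
    have h2 : ∀ ρ : Finset (ℕ+ × ℕ+ × ℕ+), Complex.exp (s * (#ρ : ℝ) * Complex.I) =
        Complex.exp (s * Complex.I) ^ #ρ := fun ρ => by
      rw [← Complex.exp_nat_mul]; congr 1; push_cast; ring
    simp_rw [h2]
    rw [h1]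
    have h3 : ∀ p ∈ range (a : ℕ) ×ˢ range (b : ℕ),
        (Complex.exp (s * Complex.I) ^ (p.1 + p.2 + 1 + c) - 1) /
          (Complex.exp (s * Complex.I) ^ (p.1 + p.2 + 1) - 1) =
        Complex.exp ((c / 2 * s : ℝ) * Complex.I) *
          ((((p.1 : ℝ) + p.2 + 1 + c) / ((p.1 : ℝ) + p.2 + 1) *
            (sinc (((p.1 : ℝ) + p.2 + 1 + c) / 2 * s) / sinc (((p.1 : ℝ) + p.2 + 1) / 2 * s)) : ℝ) : ℂ) := by
      intro p _
      have := exp_sub_one_div_exp_sub_one ((p.1 : ℝ) + p.2 + 1 + c) ((p.1 : ℝ) + p.2 + 1) s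
        (by positivity) (by positivity) h0
      rw [add_sub_cancel_left] at this
      have e : ∀ k : ℕ, Complex.exp (s * Complex.I) ^ k =
          Complex.exp ((k * s : ℝ) * Complex.I) := fun k => by
        rw [← Complex.exp_nat_mul]; congr 1; push_cast; ring
      rw [← this, e, e]
      push_cast
      rfl
    rw [prod_congr rfl h3, prod_mul_distrib, prod_const, ← Complex.ofReal_prod, prod_mul_distrib,
      ← Complex.exp_nat_mul, card_product, card_range, card_range]
    change _ = _ * ((N⁻¹ * R * ∏ p ∈ range (a : ℕ) ×ˢ range (b : ℕ),
      sinc (((p.1 : ℝ) + p.2 + 1 + c) / 2 * s) / sinc (((p.1 : ℝ) + p.2 + 1) / 2 * s) : ℝ) : ℂ)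
    rw [mul_left_comm]
    congr 1
    · congr 1; push_cast; ring
    · push_cast; rw [mul_assoc]; simp [N, R]
  have hr : (0 : ℝ) < 2 * π / (a + b) := by positivity
  -- MacMahon's formula is not available at `q = 1`, so the normalizing constant is found by letting
  -- `s` tend to `0`, where a characteristic function equals `1`.
  have hNR : N⁻¹ * R = 1 := by
    have h1 : Tendsto (charFun ((planePartitionSizeLaw a b c).law : Measure ℝ)) (𝓝[≠] 0) (𝓝 1) := by
      have := (continuous_charFun (μ := ((planePartitionSizeLaw a b c).law : Measure ℝ))).tendsto 0
      rw [charFun_zero, probReal_univ, Complex.ofReal_one] at this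
      exact this.mono_left nhdsWithin_le_nhds
    have h2 : Tendsto (fun s : ℝ => Complex.exp ((s * (a * b * c / 2) : ℝ) * Complex.I) *
          ((N⁻¹ * R * sincRatio a b c s : ℝ) : ℂ)) (𝓝[≠] 0) (𝓝 (1 * (N⁻¹ * R * 1 : ℝ))) := by
      refine Tendsto.mul ?_ ((Complex.continuous_ofReal.tendsto _).comp
        ((sincRatio_hasQuadraticExpansion a b c).tendsto_one.const_mul _))
      have : Continuous fun s : ℝ => Complex.exp ((s * (a * b * c / 2) : ℝ) * Complex.I) := by
        fun_prop
      have := this.tendsto 0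
      simp only [zero_mul, Complex.ofReal_zero, Complex.exp_zero] at this
      exact this.mono_left nhdsWithin_le_nhds
    have h3 := tendsto_nhds_unique h1 (h2.congr' ?_)
    · rw [one_mul, mul_one] at h3
      exact_mod_cast h3.symm
    · filter_upwards [self_mem_nhdsWithin, nhdsWithin_le_nhds (Metric.ball_mem_nhds (0 : ℝ) hr)]
        with s h0 hs
      exact (hgen s h0 (by simpa [Real.dist_eq] using hs)).symm
  by_cases h0 : s = 0
  · subst h0
    simp [sincRatio]
  · rw [hgen s h0 hs, hNR, one_mul]

lemma charFun_standardize_planePartitionSizeLaw (a b c : ℕ+) {t : ℝ}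
    (ht : |t / √(a * b * c * (a + b + c) / 12)| < 2 * π / (a + b)) :
    charFun ((planePartitionSizeLaw a b c).standardize.law : Measure ℝ) t =
      sincRatio a b c (t / √(a * b * c * (a + b + c) / 12)) :=
  (planePartitionSizeLaw a b c).charFun_standardize_of_eq (planePartitionSizeLaw_memLp_id a b c)
    (by positivity) (sincRatio_hasQuadraticExpansion a b c)
    (fun _ hs => charFun_planePartitionSizeLaw a b c hs) ht

end Laws

/-! ### Limits of the standardized laws -/

section Limits

open Filter Topology Real Finset

/-- For fixed `a`, `b` the standard deviation grows linearly in `c`. So `s → 0` while `c s → τ`: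
each denominator tends to `sinc 0 = 1` and each of the `a b` numerators to `sinc (τ / 2)`. -/
lemma tendsto_standardize_planePartitionSizeLaw_irwinHall (a b : ℕ+) {c : ℕ → ℕ+}
    (hc : Tendsto (fun n => (c n : ℕ)) atTop atTop) :
    Tendsto (fun n => (planePartitionSizeLaw a b (c n)).standardize) atTop
      (𝓝 (irwinHall (a * b)).standardize) := by
  refine RealLaw.tendsto_of_tendsto_charFun fun t => ?_
  rw [charFun_standardize_irwinHall]
  have hc' : Tendsto (fun n => ((c n : ℕ) : ℝ)) atTop atTop := tendsto_natCast_atTop_atTop.comp hc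
  set s : ℕ → ℝ := fun n => t / √(a * b * c n * (a + b + c n) / 12) with hs
  set τ : ℝ := t / √((a * b : ℕ) / 12)
  have hcs : Tendsto (fun n => (c n : ℝ) * s n) atTop (𝓝 τ) := by
    have h1 : Tendsto (fun n => (a * b : ℝ) / 12 * ((a + b) / (c n : ℝ) + 1)) atTop
        (𝓝 ((a * b : ℝ) / 12 * (0 + 1))) :=
      ((tendsto_const_nhds.div_atTop hc').add_const 1).const_mul _
    have h2 : Tendsto (fun n => t / √((a * b : ℝ) / 12 * ((a + b) / (c n : ℝ) + 1))) atTop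
        (𝓝 (t / √((a * b : ℝ) / 12 * (0 + 1)))) :=
      tendsto_const_nhds.div h1.sqrt (by positivity)
    have e : τ = t / √((a * b : ℝ) / 12 * (0 + 1)) := by
      simp only [τ]; push_cast; rw [zero_add, mul_one]
    rw [e]
    refine h2.congr fun n => ?_
    have hcn : (0 : ℝ) < c n := by positivity
    have : (a * b * c n * (a + b + c n) / 12 : ℝ) =
        (c n : ℝ) ^ 2 * ((a * b : ℝ) / 12 * ((a + b) / (c n : ℝ) + 1)) := by
      field_simp
    simp only [hs]
    rw [this, sqrt_mul (sq_nonneg (c n : ℝ)), sqrt_sq hcn.le]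
    field_simp
  have hs0 : Tendsto s atTop (𝓝 0) := by
    refine (hcs.div_atTop hc').congr fun n => ?_
    have hcn : (c n : ℝ) ≠ 0 := by positivity
    field_simp
  have hev : ∀ᶠ n in atTop, |s n| < 2 * π / (a + b) := by
    have : Tendsto (fun n => |s n|) atTop (𝓝 0) := by simpa using hs0.abs
    exact this.eventually (gt_mem_nhds (by positivity))
  have hlim : Tendsto (fun n => sincRatio a b (c n) (s n)) atTop (𝓝 (sinc (1 / 2 * τ) ^ (a * b : ℕ))) := by
    have : sinc (1 / 2 * τ) ^ (a * b : ℕ) =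
        ∏ p ∈ range (a : ℕ) ×ˢ range (b : ℕ), sinc (1 / 2 * τ) / sinc 0 := by
      rw [prod_const, card_product, card_range, card_range, sinc_zero, div_one]
    rw [this]
    refine tendsto_finsetProd _ fun p _ => Tendsto.div ?_ ?_ (by simp)
    · have h := (hs0.const_mul (((p.1 : ℝ) + p.2 + 1) / 2)).add (hcs.const_mul (1 / 2))
      rw [mul_zero, zero_add] at h
      refine ((continuous_sinc.tendsto _).comp h).congr fun n => ?_
      simp only [Function.comp_apply]
      congr 1; ring
    · have h := hs0.const_mul (((p.1 : ℝ) + p.2 + 1) / 2)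
      rw [mul_zero] at h
      exact (continuous_sinc.tendsto _).comp h
  refine ((Complex.continuous_ofReal.tendsto _).comp hlim).congr' ?_
  filter_upwards [hev] with n hn
  rw [charFun_standardize_planePartitionSizeLaw a b (c n) hn]
  rfl

/-- With `c` the largest side, every squared argument is at most `27 t² / (a b)`. There are `a b`
factors, so arguments are uniformly small with bounded sum of squares, and
`tendsto_prod_sinc_div_sinc` applies. -/
lemma tendsto_standardize_planePartitionSizeLaw_stdNormalLaw {a b c : ℕ → ℕ+}
    (hac : ∀ n, a n ≤ c n) (hbc : ∀ n, b n ≤ c n)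
    (hab : Tendsto (fun n => (a n * b n : ℕ)) atTop atTop) :
    Tendsto (fun n => (planePartitionSizeLaw (a n) (b n) (c n)).standardize) atTop
      (𝓝 stdNormalLaw) := by
  refine RealLaw.tendsto_of_tendsto_charFun fun t => ?_
  rw [charFun_stdNormalLaw]
  set s : ℕ → ℝ := fun n => t / √(a n * b n * c n * (a n + b n + c n) / 12) with hs
  have hab' : Tendsto (fun n => (a n * b n : ℝ)) atTop atTop := by
    have := tendsto_natCast_atTop_atTop (R := ℝ).comp hab
    refine this.congr fun n => ?_
    simp
  have hac' : ∀ n, (a n : ℝ) ≤ c n := fun n => by exact_mod_cast hac n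
  have hbc' : ∀ n, (b n : ℝ) ≤ c n := fun n => by exact_mod_cast hbc n
  have hssq : ∀ n, s n ^ 2 * (a n * b n * c n * (a n + b n + c n)) = 12 * t ^ 2 := fun n => by
    have : (0 : ℝ) < a n * b n * c n * (a n + b n + c n) / 12 := by positivity
    simp only [hs]
    rw [div_pow, sq_sqrt this.le]
    field_simp
  have hcs : ∀ n, (c n * s n) ^ 2 ≤ 12 * t ^ 2 / (a n * b n) := fun n => by
    rw [le_div_iff₀ (by positivity), ← hssq]
    have : (c n : ℝ) ^ 2 * (a n * b n) ≤ a n * b n * c n * (a n + b n + c n) := by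
      have h0 : (0 : ℝ) ≤ a n * b n * c n * (a n + b n) := by positivity
      nlinarith
    calc _ = s n ^ 2 * ((c n : ℝ) ^ 2 * (a n * b n)) := by ring
      _ ≤ _ := mul_le_mul_of_nonneg_left this (sq_nonneg _)
  have hκ : ∀ n, ∀ k : ℝ, 0 ≤ k → k ≤ 3 * c n → (k / 2 * s n) ^ 2 ≤ 27 * t ^ 2 / (a n * b n) := by
    intro n k hk0 hk
    have h1 : k ^ 2 ≤ (3 * c n) ^ 2 := by gcongr
    calc (k / 2 * s n) ^ 2 = k ^ 2 * (s n ^ 2 / 4) := by ring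
      _ ≤ (3 * c n) ^ 2 * (s n ^ 2 / 4) := mul_le_mul_of_nonneg_right h1 (by positivity)
      _ = 9 / 4 * (c n * s n) ^ 2 := by ring
      _ ≤ 9 / 4 * (12 * t ^ 2 / (a n * b n)) := by linarith [hcs n]
      _ = _ := by ring
  have hδ : Tendsto (fun n => √(27 * t ^ 2 / (a n * b n))) atTop (𝓝 0) := by
    have := (Tendsto.div_atTop (tendsto_const_nhds (x := 27 * t ^ 2)) hab').sqrt
    simpa using this
  have hm : ∀ n, ∀ p ∈ range (a n : ℕ) ×ˢ range (b n : ℕ),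
      (p.1 : ℝ) + p.2 + 1 + c n ≤ 3 * c n := by
    intro n p hp
    rw [mem_product, mem_range, mem_range] at hp
    have h1 : (p.1 : ℝ) + 1 ≤ a n := by exact_mod_cast hp.1
    have h2 : (p.2 : ℝ) + 1 ≤ b n := by exact_mod_cast hp.2
    linarith [hac' n, hbc' n]
  have hu := fun n (p : ℕ × ℕ) hp => hκ n ((p.1 : ℝ) + p.2 + 1 + c n) (by positivity) (hm n p hp)
  have hv := fun n (p : ℕ × ℕ) hp => hκ n ((p.1 : ℝ) + p.2 + 1) (by positivity) (by
    have : (0 : ℝ) < c n := by positivity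
    linarith [hm n p hp])
  have hlim : Tendsto (fun n => sincRatio (a n) (b n) (c n) (s n)) atTop
      (𝓝 (exp (-(t ^ 2 / 2)))) := by
    refine tendsto_prod_sinc_div_sinc (C := 54 * t ^ 2) hδ
      (fun n p hp => abs_le_sqrt (hu n p hp)) (fun n p hp => abs_le_sqrt (hv n p hp))
      (fun n => ?_) (fun n => ?_)
    · refine (sum_le_sum fun p hp => add_le_add (hu n p hp) (hv n p hp)).trans ?_
      rw [sum_const, card_product, card_range, card_range, nsmul_eq_mul]
      push_cast
      have : (0 : ℝ) < a n * b n := by positivity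
      apply le_of_eq
      field_simp
      ring
    · have := sum_range_prod_sq_sub_sq (a n) (b n) (c n)
      have h3 := hssq n
      rw [← this, mul_sum] at h3
      have : 3 * t ^ 2 = (12 * t ^ 2) / 4 := by ring
      rw [this, ← h3, sum_div]
      refine sum_congr rfl fun p _ => ?_
      ring
  -- The product formula holds only in this range. As `a + b ≤ 2 c`, it is enough that `c |s| < π`,
  -- the case `k = 2 c` of `hκ`.
  have hev : ∀ᶠ n in atTop, |s n| < 2 * π / (a n + b n) := by
    filter_upwards [hδ.eventually (gt_mem_nhds pi_pos)] with n hn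
    have h1 := (abs_le_sqrt (hκ n (2 * c n) (by positivity) (by
      have : (0 : ℝ) < c n := by positivity
      linarith))).trans_lt hn
    rw [lt_div_iff₀ (by positivity)]
    rw [abs_mul, abs_of_pos (by positivity : (0 : ℝ) < 2 * c n / 2)] at h1
    have h2 : |s n| * (a n + b n) ≤ |s n| * (2 * c n) :=
      mul_le_mul_of_nonneg_left (by linarith [hac' n, hbc' n]) (abs_nonneg _)
    linarith
  refine ((Complex.continuous_ofReal.tendsto _).comp hlim).congr' ?_
  filter_upwards [hev] with n hn
  rw [charFun_standardize_planePartitionSizeLaw (a n) (b n) (c n) hn]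
  rfl

lemma tendsto_standardize_irwinHall_stdNormalLaw {M : ℕ → ℕ} (hM1 : ∀ n, 1 ≤ M n)
    (hM : Tendsto M atTop atTop) :
    Tendsto (fun n => (irwinHall (M n)).standardize) atTop (𝓝 stdNormalLaw) := by
  refine RealLaw.tendsto_of_tendsto_charFun fun t => ?_
  simp_rw [charFun_standardize_irwinHall, charFun_stdNormalLaw]
  refine (Complex.continuous_ofReal.tendsto _).comp ?_
  have hpos : ∀ n, (0 : ℝ) < M n := fun n => by exact_mod_cast hM1 n
  have hM' : Tendsto (fun n => (M n : ℝ)) atTop atTop := tendsto_natCast_atTop_atTop.comp hM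
  have hsq : ∀ n, (1 / 2 * (t / √(M n / 12))) ^ 2 = 3 * t ^ 2 / M n := fun n => by
    have := hpos n
    rw [mul_pow, div_pow t, sq_sqrt (by positivity)]
    field_simp
    ring
  have hδ : Tendsto (fun n => √(3 * t ^ 2 / M n)) atTop (𝓝 0) := by
    have := (Tendsto.div_atTop (tendsto_const_nhds (x := 3 * t ^ 2)) hM').sqrt
    rwa [sqrt_zero] at this
  have := tendsto_prod_sinc_div_sinc (S := fun n => range (M n))
    (u := fun n _ => 1 / 2 * (t / √(M n / 12))) (v := fun _ _ => 0) (C := 3 * t ^ 2) (t := t) hδ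
    (fun n _ _ => abs_le_sqrt (hsq n).le) (fun n _ _ => by rw [abs_zero]; exact sqrt_nonneg _) (fun n => ?_) (fun n => ?_)
  · simpa only [sinc_zero, div_one, prod_const, card_range] using this
  all_goals
    have := hpos n
    simp only [hsq, sum_const, card_range, nsmul_eq_mul]
    field_simp
    norm_num

/-! ### Lattice laws versus Irwin–Hall and normal laws -/

lemma abs_sinc_lt_one {x : ℝ} (hx : x ≠ 0) : |sinc x| < 1 := by
  have key : ∀ y : ℝ, 0 < y → |sinc y| < 1 := fun y hy => by
    rw [sinc_of_ne_zero hy.ne', abs_div, abs_of_pos hy, div_lt_one hy, abs_lt]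
    refine ⟨?_, sin_lt hy⟩
    rcases lt_or_ge y π with h | h
    · linarith [sin_pos_of_pos_of_lt_pi hy h]
    · linarith [neg_one_le_sin y, pi_gt_three]
  rcases hx.lt_or_gt with h | h
  · rw [← sinc_neg]; exact key _ (neg_pos.2 h)
  · exact key _ h

lemma variance_planePartitionSizeLaw (a b c : ℕ+) :
    variance id ((planePartitionSizeLaw a b c).law : Measure ℝ) = a * b * c * (a + b + c) / 12 := by
  refine ((planePartitionSizeLaw a b c).integral_eq_and_variance_eq
    (planePartitionSizeLaw_memLp_id a b c) (m := a * b * c / 2)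
    (sincRatio_hasQuadraticExpansion a b c) ?_).2
  have hr : (0 : ℝ) < 2 * π / (a + b) := by positivity
  refine nhdsWithin_le_nhds ?_
  filter_upwards [Metric.ball_mem_nhds (0 : ℝ) hr] with s hs
  exact charFun_planePartitionSizeLaw a b c (by simpa [Real.dist_eq] using hs)

/-- Sizes are integers, so the unstandardized characteristic function equals `1` at `2 π`;
standardizing moves this point to `2 π σ` and adds a phase. -/
lemma exists_norm_charFun_standardize_planePartitionSizeLaw (a b c : ℕ+) :
    ∃ t : ℝ, t ≠ 0 ∧
      ‖charFun ((planePartitionSizeLaw a b c).standardize.law : Measure ℝ) t‖ = 1 := by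
  set σ := √(variance id ((planePartitionSizeLaw a b c).law : Measure ℝ)) with hσ
  have hσ0 : σ ≠ 0 := by
    rw [hσ, variance_planePartitionSizeLaw]; positivity
  refine ⟨2 * π * σ, by positivity, ?_⟩
  rw [RealLaw.charFun_standardize, norm_mul, ← Complex.ofReal_neg,
    Complex.norm_exp_ofReal_mul_I, one_mul,
    ← hσ, mul_div_assoc, div_self hσ0, mul_one, charFun_apply_real, integral_planePartitionSizeLaw]
  have : ∀ ρ : Finset (ℕ+ × ℕ+ × ℕ+),
      Complex.exp ((2 * π : ℝ) * (#ρ : ℝ) * Complex.I) = 1 := fun ρ => by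
    rw [← Complex.exp_nat_mul_two_pi_mul_I #ρ]
    congr 1; push_cast; ring
  simp_rw [this]
  rw [sum_const, nsmul_eq_mul, mul_one, inv_mul_cancel₀, norm_one]
  simpa using (planePartitions_nonempty a b c).ne_empty

lemma disjoint_planePartitionModuli :
    Disjoint planePartitionModuli (irwinHallModuli ∪ {stdNormalLaw}) := by
  rw [Set.disjoint_left]
  rintro x ⟨a, b, c, rfl⟩ hx
  obtain ⟨t, ht, h1⟩ := exists_norm_charFun_standardize_planePartitionSizeLaw a b c
  rcases hx with ⟨M, hM, h⟩ | h
  · rw [h, charFun_standardize_irwinHall, Complex.norm_real, norm_pow] at h1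
    have hM0 : (0 : ℝ) < M := by exact_mod_cast hM
    have h2 := abs_sinc_lt_one (x := 1 / 2 * (t / √(M / 12))) (by positivity)
    exact (pow_lt_one₀ (norm_nonneg _) h2 (by omega)).ne h1
  · rw [Set.mem_singleton_iff] at h
    rw [h, charFun_stdNormalLaw, Complex.norm_real, Real.norm_of_nonneg (exp_pos _).le,
      exp_eq_one_iff] at h1
    have : 0 < t ^ 2 := by positivity
    linarith

/-! ### Symmetry of the size law in the side lengths -/

lemma map_mem_planePartitions {a b c a' b' c' : ℕ+} {e : ℕ+ × ℕ+ × ℕ+ → ℕ+ × ℕ+ × ℕ+}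
    (he : Function.Involutive e) (hmono : Monotone e) (hbox : e (a, b, c) = (a', b', c'))
    {ρ : Finset (ℕ+ × ℕ+ × ℕ+)} (hρ : ρ ∈ planePartitions a b c) :
    ρ.map ⟨e, he.injective⟩ ∈ planePartitions a' b' c' := by
  obtain ⟨h1, h2⟩ := mem_planePartitions.1 hρ
  refine mem_planePartitions.2 ⟨fun i j k hp => ?_, fun p q hqp hp => ?_⟩
  · obtain ⟨⟨i', j', k'⟩, hp', h⟩ := Finset.mem_map.1 hp
    have := h1 _ _ _ hp'
    have h3 := hmono (show (i', j', k') ≤ (a, b, c) from ⟨this.1, this.2.1, this.2.2⟩)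
    rw [hbox] at h3
    rw [Function.Embedding.coeFn_mk] at h
    rw [h] at h3
    exact ⟨h3.1, h3.2.1, h3.2.2⟩
  · obtain ⟨p', hp', rfl⟩ := Finset.mem_map.1 (mem_coe.1 hp)
    have h3 := hmono hqp
    rw [Function.Embedding.coeFn_mk, he p'] at h3
    exact mem_coe.2 (Finset.mem_map.2 ⟨e q, h2 h3 hp', he q⟩)

/-- A monotone involution is an order automorphism, so it carries order ideals to order ideals of
the same size. It is applied to coordinate swaps, to make the third side the largest. -/
lemma planePartitionSizeLaw_congr {a b c a' b' c' : ℕ+} {e : ℕ+ × ℕ+ × ℕ+ → ℕ+ × ℕ+ × ℕ+}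
    (he : Function.Involutive e) (hmono : Monotone e) (hbox : e (a, b, c) = (a', b', c')) :
    planePartitionSizeLaw a b c = planePartitionSizeLaw a' b' c' := by
  have hbox' : e (a', b', c') = (a, b, c) := by rw [← hbox, he]
  have hmap : ∀ ρ : Finset (ℕ+ × ℕ+ × ℕ+),
      (ρ.map ⟨e, he.injective⟩).map ⟨e, he.injective⟩ = ρ := fun ρ => by
    ext p
    simp only [Finset.mem_map, Function.Embedding.coeFn_mk, exists_exists_and_eq_and, he _,
      exists_eq_right]
  have hbij : ∀ {A : Type} [AddCommMonoid A] (f : ℕ → A),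
      ∑ ρ ∈ planePartitions a b c, f #ρ = ∑ ρ ∈ planePartitions a' b' c', f #ρ := fun f =>
    sum_bij' (fun ρ _ => ρ.map ⟨e, he.injective⟩) (fun ρ _ => ρ.map ⟨e, he.injective⟩)
      (fun _ h => map_mem_planePartitions he hmono hbox h)
      (fun _ h => map_mem_planePartitions he hmono hbox' h)
      (fun ρ _ => hmap ρ) (fun ρ _ => hmap ρ) (fun ρ _ => by rw [card_map])
  refine RealLaw.ext (Subtype.ext ?_)
  refine (planePartitionSizeLaw_eq_sum_dirac a b c).trans
    (Eq.trans ?_ (planePartitionSizeLaw_eq_sum_dirac a' b' c').symm)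
  rw [hbij fun k => Measure.dirac (k : ℝ), card_eq_sum_ones, hbij fun _ => (1 : ℕ),
    ← card_eq_sum_ones]

lemma exists_le_of_mem_planePartitionModuli {x : RealLaw} (hx : x ∈ planePartitionModuli) :
    ∃ a b c : ℕ+, a ≤ c ∧ b ≤ c ∧ x = (planePartitionSizeLaw a b c).standardize := by
  obtain ⟨a, b, c, rfl⟩ := hx
  have h13 : planePartitionSizeLaw a b c = planePartitionSizeLaw c b a :=
    planePartitionSizeLaw_congr (e := fun p => (p.2.2, p.2.1, p.1)) (fun _ => rfl)
      (fun _ _ h => ⟨h.2.2, h.2.1, h.1⟩) rfl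
  have h23 : planePartitionSizeLaw a b c = planePartitionSizeLaw a c b :=
    planePartitionSizeLaw_congr (e := fun p => (p.1, p.2.2, p.2.1)) (fun _ => rfl)
      (fun _ _ h => ⟨h.1, h.2.2, h.2.1⟩) rfl
  rcases le_total a c with hac | hac
  · rcases le_total b c with hbc | hbc
    · exact ⟨a, b, c, hac, hbc, rfl⟩
    · exact ⟨a, c, b, hac.trans hbc, hbc, by rw [h23]⟩
  · rcases le_total b a with hba | hba
    · exact ⟨c, b, a, hac, hba, by rw [h13]⟩
    · exact ⟨a, c, b, hba, hac.trans hba, by rw [h23]⟩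

/-! ### Closures -/

lemma exists_subseq_const_or_tendsto_cofinite {α : Type*} (u : ℕ → α) :
    (∃ x, ∃ φ : ℕ → ℕ, StrictMono φ ∧ ∀ n, u (φ n) = x) ∨ Tendsto u atTop cofinite := by
  by_cases h : ∃ x, ∃ᶠ n in atTop, u n = x
  · obtain ⟨x, hx⟩ := h
    obtain ⟨φ, hφ, H⟩ := extraction_of_frequently_atTop hx
    exact Or.inl ⟨x, φ, hφ, H⟩
  · refine Or.inr (le_cofinite_iff_eventually_ne.2 fun x => ?_)
    push Not at h
    exact eventually_map.2 (h x)

lemma exists_subseq_tendsto_irwinHall {M : ℕ → ℕ} (hM : ∀ n, 1 ≤ M n) :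
    ∃ x ∈ irwinHallModuli ∪ {stdNormalLaw}, ∃ φ : ℕ → ℕ, StrictMono φ ∧
      Tendsto (fun n => (irwinHall (M (φ n))).standardize) atTop (𝓝 x) := by
  rcases exists_subseq_const_or_tendsto_cofinite M with ⟨m, φ, hφ, H⟩ | h
  · refine ⟨_, Or.inl ⟨m, H 0 ▸ hM (φ 0), rfl⟩, φ, hφ, ?_⟩
    simp only [H]
    exact tendsto_const_nhds
  · rw [Nat.cofinite_eq_atTop] at h
    exact ⟨_, Or.inr rfl, id, strictMono_id, tendsto_standardize_irwinHall_stdNormalLaw hM h⟩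

lemma exists_subseq_tendsto_planePartitionSizeLaw {a b c : ℕ → ℕ+} (hac : ∀ n, a n ≤ c n)
    (hbc : ∀ n, b n ≤ c n) (hc : Tendsto (fun n => (c n : ℕ)) atTop atTop) :
    ∃ x ∈ irwinHallModuli ∪ {stdNormalLaw}, ∃ φ : ℕ → ℕ, StrictMono φ ∧
      Tendsto (fun n => (planePartitionSizeLaw (a (φ n)) (b (φ n)) (c (φ n))).standardize) atTop
        (𝓝 x) := by
  rcases exists_subseq_const_or_tendsto_cofinite (fun n => (a n, b n)) with ⟨⟨A, B⟩, φ, hφ, H⟩ | h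
  · refine ⟨_, Or.inl ⟨A * B, Nat.mul_pos A.pos B.pos, rfl⟩, φ, hφ, ?_⟩
    have hA : ∀ n, a (φ n) = A := fun n => congrArg Prod.fst (H n)
    have hB : ∀ n, b (φ n) = B := fun n => congrArg Prod.snd (H n)
    simp only [hA, hB]
    exact tendsto_standardize_planePartitionSizeLaw_irwinHall A B (hc.comp hφ.tendsto_atTop)
  · refine ⟨_, Or.inr rfl, id, strictMono_id,
      tendsto_standardize_planePartitionSizeLaw_stdNormalLaw hac hbc ?_⟩
    -- Both factors are at least `1`, so a bound on the product bounds each of them and leaves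
    -- finitely many pairs.
    have hprod : Tendsto (fun p : ℕ+ × ℕ+ => (p.1 * p.2 : ℕ)) cofinite atTop := by
      refine tendsto_atTop.2 fun k => ?_
      refine ((Set.finite_Iic (k.succPNat, k.succPNat)).subset fun p hp => ?_ :
        {p : ℕ+ × ℕ+ | ¬ k ≤ (p.1 * p.2 : ℕ)}.Finite)
      have h1 : (p.1 * p.2 : ℕ) < k := not_le.1 hp
      have h2 := p.1.pos
      have h3 := p.2.pos
      constructor <;> rw [← PNat.coe_le_coe, Nat.succPNat_coe] <;> nlinarith
    exact hprod.comp h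

lemma tendsto_third_of_tendsto_cofinite {a b c : ℕ → ℕ+} (hac : ∀ n, a n ≤ c n)
    (hbc : ∀ n, b n ≤ c n) (h : Tendsto (fun n => (a n, b n, c n)) atTop cofinite) :
    Tendsto (fun n => (c n : ℕ)) atTop atTop := by
  refine tendsto_atTop.2 fun k => ?_
  have := h ((Set.finite_Iic (k.succPNat, k.succPNat, k.succPNat)).compl_mem_cofinite)
  filter_upwards [this] with n hn
  by_contra hlt
  have hck : c n ≤ k.succPNat := by
    rw [← PNat.coe_le_coe, Nat.succPNat_coe]; omega
  exact hn ⟨(hac n).trans hck, (hbc n).trans hck, hck⟩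

lemma isCompact_irwinHallModuli_union : IsCompact (irwinHallModuli ∪ {stdNormalLaw}) := by
  refine isCompact_iff_isSeqCompact.2 fun u hu => ?_
  by_cases h : ∃ᶠ n in atTop, u n = stdNormalLaw
  · obtain ⟨φ, hφ, H⟩ := extraction_of_frequently_atTop h
    exact ⟨_, Or.inr rfl, φ, hφ, tendsto_const_nhds.congr fun n => (H n).symm⟩
  · obtain ⟨N, hN⟩ := eventually_atTop.1 (not_frequently.1 h)
    have : ∀ n, ∃ M, 1 ≤ M ∧ u (n + N) = (irwinHall M).standardize := fun n =>
      (hu (n + N)).resolve_right (hN _ (by omega))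
    choose M hM hM' using this
    obtain ⟨x, hx, φ, hφ, hlim⟩ := exists_subseq_tendsto_irwinHall hM
    refine ⟨x, hx, fun n => φ n + N, fun m n hmn => by simpa using hφ hmn, ?_⟩
    exact hlim.congr fun n => (hM' _).symm

/-- Either one box recurs infinitely often or the boxes leave every finite set, which forces the
longest side to infinity. The first alternative records constancy, not mere convergence, as the
limit point argument needs it. -/
lemma exists_subseq_tendsto_of_mem_planePartitionModuli {u : ℕ → RealLaw}
    (hu : ∀ n, u n ∈ planePartitionModuli) :
    (∃ x ∈ planePartitionModuli, ∃ φ : ℕ → ℕ, StrictMono φ ∧ ∀ n, u (φ n) = x) ∨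
      ∃ x ∈ irwinHallModuli ∪ {stdNormalLaw}, ∃ φ : ℕ → ℕ, StrictMono φ ∧
        Tendsto (u ∘ φ) atTop (𝓝 x) := by
  choose a b c hac hbc hu' using fun n => exists_le_of_mem_planePartitionModuli (hu n)
  rcases exists_subseq_const_or_tendsto_cofinite (fun n => (a n, b n, c n)) with
    ⟨⟨A, B, C⟩, φ, hφ, H⟩ | h
  · refine Or.inl ⟨_, ⟨A, B, C, rfl⟩, φ, hφ, fun n => ?_⟩
    have := H n
    simp only [Prod.mk.injEq] at this
    rw [hu', this.1, this.2.1, this.2.2]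
  · obtain ⟨x, hx, φ, hφ, hlim⟩ := exists_subseq_tendsto_planePartitionSizeLaw hac hbc
      (tendsto_third_of_tendsto_cofinite hac hbc h)
    exact Or.inr ⟨x, hx, φ, hφ, hlim.congr fun n => (hu' _).symm⟩

lemma isCompact_planePartitionModuli_union :
    IsCompact (planePartitionModuli ∪ (irwinHallModuli ∪ {stdNormalLaw})) := by
  refine isCompact_iff_isSeqCompact.2 fun u hu => ?_
  by_cases h : ∃ᶠ n in atTop, u n ∈ planePartitionModuli
  · obtain ⟨ψ, hψ, H⟩ := extraction_of_frequently_atTop h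
    rcases exists_subseq_tendsto_of_mem_planePartitionModuli H with
      ⟨x, hx, φ, hφ, hconst⟩ | ⟨x, hx, φ, hφ, hlim⟩
    · exact ⟨x, Or.inl hx, ψ ∘ φ, hψ.comp hφ, tendsto_const_nhds.congr fun n => (hconst n).symm⟩
    · exact ⟨x, Or.inr hx, ψ ∘ φ, hψ.comp hφ, hlim⟩
  · obtain ⟨N, hN⟩ := eventually_atTop.1 (not_frequently.1 h)
    obtain ⟨x, hx, φ, hφ, hlim⟩ := isCompact_irwinHallModuli_union.isSeqCompact
      (x := fun n => u (n + N)) fun n => (hu (n + N)).resolve_left (hN _ (by omega))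
    exact ⟨x, Or.inr hx, fun n => φ n + N, fun m n hmn => by simpa using hφ hmn, hlim⟩

lemma irwinHallModuli_subset_closure : irwinHallModuli ⊆ closure planePartitionModuli := by
  rintro x ⟨M, hM, rfl⟩
  -- Boxes `1 × M × (n + 1)` realize the Irwin–Hall law with index `1 * M`.
  have h := tendsto_standardize_planePartitionSizeLaw_irwinHall 1 ⟨M, hM⟩ (c := Nat.succPNat)
    (by simpa using tendsto_add_atTop_nat 1)
  simp only [PNat.one_coe, one_mul, PNat.mk_coe] at h
  exact mem_closure_of_tendsto h (Eventually.of_forall fun n => ⟨_, _, _, rfl⟩)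

lemma closure_irwinHallModuli : closure irwinHallModuli = irwinHallModuli ∪ {stdNormalLaw} := by
  refine subset_antisymm
    (closure_minimal Set.subset_union_left isCompact_irwinHallModuli_union.isClosed)
    (Set.union_subset subset_closure ?_)
  rw [Set.singleton_subset_iff]
  exact mem_closure_of_tendsto (tendsto_standardize_irwinHall_stdNormalLaw (M := fun n => n + 1)
    (fun n => by omega) (tendsto_add_atTop_nat 1))
    (Eventually.of_forall fun n => ⟨n + 1, by omega, rfl⟩)

lemma closure_irwinHallModuli_subset : closure irwinHallModuli ⊆ closure planePartitionModuli :=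
  closure_minimal irwinHallModuli_subset_closure isClosed_closure

lemma closure_planePartitionModuli :
    closure planePartitionModuli = planePartitionModuli ∪ closure irwinHallModuli := by
  refine subset_antisymm (closure_minimal Set.subset_union_left ?_)
    (Set.union_subset subset_closure closure_irwinHallModuli_subset)
  rw [closure_irwinHallModuli]
  exact isCompact_planePartitionModuli_union.isClosed

lemma derivedSet_planePartitionModuli :
    derivedSet planePartitionModuli = closure irwinHallModuli := by
  refine subset_antisymm (fun x hx => ?_) (fun x hx => ?_)
  · rw [mem_derivedSet, accPt_principal_iff_clusterPt, ← mem_closure_iff_clusterPt,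
      mem_closure_iff_seq_limit] at hx
    obtain ⟨u, hu, hlim⟩ := hx
    rw [closure_irwinHallModuli]
    rcases exists_subseq_tendsto_of_mem_planePartitionModuli fun n => (hu n).1 with
      ⟨y, -, φ, hφ, hconst⟩ | ⟨y, hy, φ, hφ, hlim'⟩
    · have h1 : Tendsto (u ∘ φ) atTop (𝓝 y) := tendsto_const_nhds.congr fun n => (hconst n).symm
      have h2 := tendsto_nhds_unique h1 (hlim.comp hφ.tendsto_atTop)
      exact absurd ((hconst 0).trans h2) (hu (φ 0)).2
    · rwa [tendsto_nhds_unique (hlim.comp hφ.tendsto_atTop) hlim']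
  · have h1 := closure_irwinHallModuli_subset hx
    rw [closure_eq_self_union_derivedSet] at h1
    -- A closure point outside the set is an accumulation point, and disjointness puts `x` outside.
    refine h1.resolve_left fun h2 => ?_
    rw [closure_irwinHallModuli] at hx
    exact Set.disjoint_left.1 disjoint_planePartitionModuli h2 hx

end Limits

end

theorem corollary1p6 :
    -- the closure is the disjoint union of the space with the closure of the Irwin–Hall space
    closure planePartitionModuli = planePartitionModuli ∪ closure irwinHallModuli ∧
    Disjoint planePartitionModuli (closure irwinHallModuli) ∧
    -- it is compact
    IsCompact (closure planePartitionModuli) ∧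
    -- the set of limit (accumulation) points
    derivedSet planePartitionModuli = closure irwinHallModuli ∧
    -- the closure of the Irwin–Hall space adds just the standard normal law
    closure irwinHallModuli = irwinHallModuli ∪ {stdNormalLaw} := by
  refine ⟨closure_planePartitionModuli, ?_, ?_, derivedSet_planePartitionModuli,
    closure_irwinHallModuli⟩
  · rw [closure_irwinHallModuli]
    exact disjoint_planePartitionModuli
  · rw [closure_planePartitionModuli, closure_irwinHallModuli]
    exact isCompact_planePartitionModuli_union
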